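/- Let $K$ be a field of characteristic $0$ (for instance $K=\mathbb C$, or $K=\mathbb C(p_0)$ if $p_0$ is regarded as a formal parameter), and let $k,p_0\in K$. Let $\Lambda^{\pm}$ be the polynomial algebra over $K$ with free generators $p_a$, $a\in\mathbb Z\setminus\{0\}$; the symbol $p_a$ with index $a=0$ denotes the scalar $p_0$. Let $*$ be the $K$-algebra involution of $\Lambda^{\pm}$ with $p_a^*=p_{-a}$, extended to $\Lambda^{\pm}[x,x^{-1}]$ by $x^*=x^{-1}$, and, for $k\neq 0$, let $\theta$ be the $K$-algebra automorphism of $\Lambda^{\pm}$ with $\theta(p_a)=k\,p_a$ for all $a\ne 0$. On $\Lambda^{\pm}[x,x^{-1}]$ let $\partial$ be the $K$-linear derivation with $\partial(x)=x$ and $\partial(p_a)=a\,x^{a}$ ($a\neq0$), let $\Delta_{p_0}$ be the $\Lambda^{\pm}$-linear operator with $\Delta_{p_0}(1)=0$, $$\Delta_{p_0}(x^l)=x^lp_0+2x^{l-1}p_1+\dots+2xp_{l-1}+p_l-2l\,x^l\quad(l>0),\qquad \Delta_{p_0}(x^{l})=-\bigl(\Delta_{p_0}(x^{-l})\bigr)^*\quad(l<0),$$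 and let $D_{k,p_0}=\partial-\tfrac k2\Delta_{p_0}$ (the infinite-dimensional Dunkl--Heckman operator). Let $E_{p_0}:\Lambda^{\pm}[x,x^{-1}]\to\Lambda^{\pm}$ be the $\Lambda^{\pm}$-linear map with $E_{p_0}(x^l)=p_l$ for all $l\in\mathbb Z$, and for $r\in\mathbb Z_{\ge 0}$ let $$\mathcal L^{(r)}_{k,p_0}=\bigl(E_{p_0}\circ D_{k,p_0}^{\,r}\bigr)\big|_{\Lambda^{\pm}}:\Lambda^{\pm}\to\Lambda^{\pm}.$$ A $K$-linear operator $L$ on $\Lambda^\pm$ is a differential operator of order at most $n$ if $[\dots[[L,f_0],f_1],\dots,f_n]=0$ for all $f_0,\dots,f_n\in\Lambda^{\pm}$, acting by multiplication. Write $L^*$ for the operator $f\mapsto (L(f^*))^*$. Then: 1. For every $r\ge 0$, $\mathcal L^{(r)}_{k,p_0}$ is a differential operator of order $r$: of order at most $r$, and, if $r\geq 1$, not of order at most $r-1$. 2. For every $r\ge0$ and $k$, the operator $\mathcal L^{(r)}_{k,p_0}$ depends polynomially on $p_0$: there are finitely many differential operators $A_0,\dots,A_m$ of order at most $r$, not depending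 on $p_0$, with $\mathcal L^{(r)}_{k,p_0}=\sum_{i=0}^m p_0^{\,i}A_i$ for all $p_0\in K$. 3. If $k\ne0$, then $\theta^{-1}\circ\mathcal L^{(r)}_{k,p_0}\circ\theta=k^{r-1}\,\mathcal L^{(r)}_{k^{-1},\,kp_0}$ for every $r\ge 0$. 4. $(\mathcal L^{(r)}_{k,p_0})^*=(-1)^r\,\mathcal L^{(r)}_{k,p_0}$ for every $r\ge0$. 5. With $\partial_a=a\,\partial/\partial p_a$ for $a\ne0$ and $\partial_0=0$, $$\mathcal L^{(2)}_{k,p_0}=\sum_{a,b\in\mathbb Z}p_{a+b}\partial_a\partial_b-k\Bigl[\sum_{a,b>0}p_ap_b\partial_{a+b}-\sum_{a,b<0}p_ap_b\partial_{a+b}\Bigr]-kp_0\Bigl[\sum_{a>0}p_a\partial_a-\sum_{a<0}p_a\partial_a\Bigr]+(1+k)\sum_{a\in\mathbb Z}a\,p_a\partial_a$$ (the Laurent CMS operator at infinity; on each element of $\Lambda^\pm$ only finitely many terms are non-zero). 6. $[\mathcal L^{(r)}_{k,p_0},\mathcal L^{(s)}_{k,p_0}]=0$ for all $r,s\ge0$.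 -/

import Mathlib

noncomputable section

namespace JackLaurent

open LaurentPolynomial

variable (K : Type*) [Field K]

/-- The algebra `Λ^±` of Laurent symmetric functions, with free generators `p_a`, `a ∈ ℤ ∖ {0}`. -/
abbrev LSym : Type _ := MvPolynomial {a : ℤ // a ≠ 0} K

/-- The algebra `Λ^±[x, x⁻¹]`; the power `x ^ l` is `T l`. -/
abbrev LSymX : Type _ := LaurentPolynomial (LSym K)

variable {K}

/-- The power sum `p_l`, `l ∈ ℤ`: a free generator for `l ≠ 0`, the parameter `p₀` for `l = 0`. -/
def p (p0 : K) (l : ℤ) : LSym K :=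
  if h : l = 0 then MvPolynomial.C p0 else MvPolynomial.X ⟨l, h⟩

/-- The operator `∂_a = a ∂/∂p_a` on `Λ^±`; in particular `∂_0 = 0`. -/
def dd (a : ℤ) : LSym K →ₗ[K] LSym K :=
  if h : a = 0 then 0 else (a : K) • (MvPolynomial.pderiv ⟨a, h⟩).toLinearMap

/-- The involution `*` of `Λ^±`: the `K`-algebra homomorphism with `p_a ↦ p_{-a}`. -/
def starHom : LSym K →ₐ[K] LSym K :=
  MvPolynomial.rename fun a => ⟨-a.1, neg_ne_zero.mpr a.2⟩

/-- The involution `*` extended to `Λ^±[x, x⁻¹]` by `x ↦ x⁻¹`. -/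
def starX (g : LSymX K) : LSymX K :=
  invert (AddMonoidAlgebra.mapRingHom ℤ (starHom (K := K)).toRingHom g)

/-- The homomorphism `θ : Λ^± → Λ^±`, `p_a ↦ k p_a`. -/
def thetaHom (k : K) : LSym K →ₐ[K] LSym K :=
  MvPolynomial.aeval fun a => k • MvPolynomial.X a

/-- For `k ≠ 0` the homomorphism `θ` is an automorphism of `Λ^±`. -/
def theta (k : K) (hk : k ≠ 0) : LSym K ≃ₐ[K] LSym K :=
  AlgEquiv.ofAlgHom (thetaHom k) (thetaHom k⁻¹)
    (by ext a; simp [thetaHom, smul_smul, hk])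
    (by ext a; simp [thetaHom, smul_smul, hk])

/-- The restriction of `∂` to `Λ^±`: the derivation `Λ^± → Λ^±[x, x⁻¹]` with `p_a ↦ a x^a`. -/
def partialLSym : Derivation K (LSym K) (LSymX K) :=
  MvPolynomial.mkDerivation K fun a => (a.1 : LSymX K) * T a.1

/-- The `K`-linear map `x^l f ↦ x^l (l f + ∂ f)`, `f ∈ Λ^±`. -/
def partialLin : LSymX K →ₗ[K] LSymX K :=
  (Finsupp.lsum K fun l : ℤ =>
      LinearMap.mulLeft K (T l : LSymX K) ∘ₗ
        ((l : K) • (Algebra.linearMap (LSym K) (LSymX K)).restrictScalars K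
          + partialLSym.toLinearMap)) ∘ₗ
    (AddMonoidAlgebra.coeffLinearEquiv K).toLinearMap

lemma partialLin_apply (f : LSym K) (l : ℤ) :
    partialLin (C f * T l) = T l * ((l : K) • C f + partialLSym f) := by
  rw [← single_eq_C_mul_T]
  simp [partialLin, -single_eq_C_mul_T, C_eq_algebraMap]

lemma partialLin_mul (g h : LSymX K) :
    partialLin (g * h) = g • partialLin h + h • partialLin g := by
  induction g using LaurentPolynomial.induction_on' with
  | add g₁ g₂ h₁ h₂ => rw [add_mul, map_add, h₁, h₂, map_add, add_smul, smul_add]; abel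
  | C_mul_T m a =>
    induction h using LaurentPolynomial.induction_on' with
    | add g₁ g₂ h₁ h₂ => rw [mul_add, map_add, h₁, h₂, map_add, add_smul, smul_add]; abel
    | C_mul_T n b =>
      have e : (C a * T m * (C b * T n) : LSymX K) = C (a * b) * T (m + n) := by
        rw [map_mul, T_add]; ring
      rw [e, partialLin_apply, partialLin_apply, partialLin_apply, Derivation.leibniz]
      simp only [T_add, Int.cast_add, map_mul, map_add, smul_eq_mul, Algebra.smul_def,
        ← LaurentPolynomial.C_eq_algebraMap]
      ring

/-- The differentiation `∂` of `Λ^±[x, x⁻¹]` with `∂ x = x` and `∂ p_a = a x^a`. -/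
def partialX : Derivation K (LSymX K) (LSymX K) := Derivation.mk' partialLin partialLin_mul

/-- `Δ_{p₀}(x^l)` for `l > 0`: `x^l p₀ + 2 x^{l-1} p_1 + ⋯ + 2 x p_{l-1} + p_l - 2 l x^l`. -/
def deltaPos (p0 : K) (l : ℕ) : LSymX K :=
  T l * C (p p0 0) + (∑ j ∈ Finset.Ioo 0 l, 2 * (T ((l : ℤ) - j) * C (p p0 j)))
    + C (p p0 l) - 2 * (l : LSymX K) * T l

/-- `Δ_{p₀}(x^l)` for `l ∈ ℤ`: it is `0` for `l = 0`, and `-(Δ_{p₀}(x^{-l}))^*` for `l < 0`. -/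
def deltaMonomial (p0 : K) (l : ℤ) : LSymX K :=
  if 0 < l then deltaPos p0 l.natAbs
  else if l = 0 then 0
  else -starX (deltaPos p0 l.natAbs)

/-- The `Λ^±`-linear map on `Λ^±[x, x⁻¹]` with `x^l ↦ v l`. -/
def ofMonomials {M : Type*} [AddCommGroup M] [Module (LSym K) M] (v : ℤ → M) :
    LSymX K →ₗ[LSym K] M :=
  Finsupp.linearCombination (LSym K) v ∘ₗ
    (AddMonoidAlgebra.coeffLinearEquiv (LSym K)).toLinearMap

/-- The operator `Δ_{p₀}`: `Δ_{p₀}(x^l f) = Δ_{p₀}(x^l) f` for `f ∈ Λ^±`. -/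
def Delta (p0 : K) : LSymX K →ₗ[LSym K] LSymX K := ofMonomials (deltaMonomial p0)

/-- The infinite-dimensional Dunkl–Heckman operator `D_{k,p₀} = ∂ - (k/2) Δ_{p₀}`. -/
def dunkl (k p0 : K) : Module.End K (LSymX K) :=
  partialX.toLinearMap - (k / 2) • (Delta p0).restrictScalars K

/-- The operator `E_{p₀} : x^l f ↦ p_l f`, `f ∈ Λ^±`. -/
def evalE (p0 : K) : LSymX K →ₗ[LSym K] LSym K := ofMonomials (p p0)

/-- The operator `𝓛^{(r)}_{k,p₀} = E_{p₀} ∘ D_{k,p₀}^r`, restricted to `Λ^±`. -/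
def cmsIntegral (k p0 : K) (r : ℕ) : Module.End K (LSym K) :=
  (evalE p0).restrictScalars K ∘ₗ (dunkl k p0 ^ r) ∘ₗ
    (Algebra.linearMap (LSym K) (LSymX K)).restrictScalars K

/-- The operator `L^* : f ↦ (L (f^*))^*`. -/
def starConj (L : Module.End K (LSym K)) : Module.End K (LSym K) :=
  starHom.toLinearMap ∘ₗ L ∘ₗ starHom.toLinearMap

/-- Differential operators of order at most `n` on a commutative algebra (Grothendieck). -/
def IsDiffOpLE {A : Type*} [CommRing A] [Algebra K A] : ℕ → Module.End K A → Prop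
  | 0, L => ∀ f : A, L * LinearMap.mulLeft K f - LinearMap.mulLeft K f * L = 0
  | n + 1, L => ∀ f : A, IsDiffOpLE n (L * LinearMap.mulLeft K f - LinearMap.mulLeft K f * L)

/-- Differential operators of order `n`, not of smaller order. -/
def IsDiffOp {A : Type*} [CommRing A] [Algebra K A] (n : ℕ) (L : Module.End K A) : Prop :=
  IsDiffOpLE n L ∧ ∀ m < n, ¬ IsDiffOpLE m L

lemma finite_dd (f : LSym K) : {a : ℤ | dd a f ≠ 0}.Finite := by
  refine ((f.vars.finite_toSet).image Subtype.val).subset fun a ha => ?_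
  by_cases h : a = 0
  · simp [dd, h] at ha
  · refine ⟨⟨a, h⟩, ?_, rfl⟩
    by_contra hv
    exact ha (by simp [dd, h, MvPolynomial.pderiv_eq_zero_of_notMem_vars hv])

lemma finite_dd_dd (f : LSym K) : {ab : ℤ × ℤ | dd ab.1 (dd ab.2 f) ≠ 0}.Finite := by
  refine ((finite_dd f).biUnion fun b _ =>
    (finite_dd (dd b f)).image fun a => (a, b)).subset fun ab h => ?_
  refine Set.mem_biUnion (x := ab.2) ?_ ⟨ab.1, h, rfl⟩
  intro h0
  exact h (by rw [h0, map_zero])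

lemma finite_dd_pos (f : LSym K) :
    {ab : {ab : ℤ × ℤ // 0 < ab.1 ∧ 0 < ab.2} | dd (ab.1.1 + ab.1.2) f ≠ 0}.Finite := by
  refine Set.Finite.of_finite_image (f := Subtype.val) ?_ Subtype.val_injective.injOn
  refine ((finite_dd f).biUnion fun c _ =>
    (Set.finite_Icc 0 c).prod (Set.finite_Icc 0 c)).subset ?_
  rintro _ ⟨⟨⟨a, b⟩, ha, hb⟩, h, rfl⟩
  refine Set.mem_biUnion (x := a + b) h ?_
  simp only [Set.mem_prod, Set.mem_Icc] at *
  omega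

lemma finite_dd_neg (f : LSym K) :
    {ab : {ab : ℤ × ℤ // ab.1 < 0 ∧ ab.2 < 0} | dd (ab.1.1 + ab.1.2) f ≠ 0}.Finite := by
  refine Set.Finite.of_finite_image (f := Subtype.val) ?_ Subtype.val_injective.injOn
  refine ((finite_dd f).biUnion fun c _ =>
    (Set.finite_Icc c 0).prod (Set.finite_Icc c 0)).subset ?_
  rintro _ ⟨⟨⟨a, b⟩, ha, hb⟩, h, rfl⟩
  refine Set.mem_biUnion (x := a + b) h ?_
  simp only [Set.mem_prod, Set.mem_Icc] at *
  omega

/-- The Laurent CMS operator at infinity. On each `f` every sum has only finitely many non-zero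
terms, by the four lemmas above. -/
def laurentCMS (k p0 : K) (f : LSym K) : LSym K :=
  (∑ᶠ ab : ℤ × ℤ, p p0 (ab.1 + ab.2) * dd ab.1 (dd ab.2 f))
    - k • ((∑ᶠ ab : {ab : ℤ × ℤ // 0 < ab.1 ∧ 0 < ab.2},
              p p0 ab.1.1 * p p0 ab.1.2 * dd (ab.1.1 + ab.1.2) f)
          - ∑ᶠ ab : {ab : ℤ × ℤ // ab.1 < 0 ∧ ab.2 < 0},
              p p0 ab.1.1 * p p0 ab.1.2 * dd (ab.1.1 + ab.1.2) f)
    - (k * p0) • ((∑ᶠ a : {a : ℤ // 0 < a}, p p0 a * dd a f)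
          - ∑ᶠ a : {a : ℤ // a < 0}, p p0 a * dd a f)
    + (1 + k) • ∑ᶠ a : ℤ, (a : K) • (p p0 a * dd a f)

end JackLaurent

end

noncomputable section

namespace JackLaurent

open LaurentPolynomial

/-! The guiding picture is a system of `N` particles: `p_a` is the power sum of `x_1, ..., x_N`,
`p₀` is `N`, and `x` is the variable of a chosen particle. `E` sums over the choice of that
particle, and `D` becomes Heckman's operator `x_i ∂_i - (k/2) ∑_j (x_i + x_j)/(x_i - x_j) (1 -
s_ij)`. No limit in `N` is taken. All identities are proved formally, mostly from the value at `1`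
and the relations with multiplication by `x` and by `p_a`. A difference of two operators that
commutes with these multiplications is linear over the whole Laurent ring, hence is determined by
its value at `1` (`eq_of_commutes_generators`).

The `θ`-symmetry is such a comparison for `D`. The `*`-symmetry holds because `D` anticommutes with
`*`. The order is at most `r` because `D` has order one while `E` and the inclusion of `Λ^±` are
`Λ^±`-linear. It is not smaller because `[D, p_1] = x`: the `r`-fold commutator of `E D^r` with
`p_1` sends `1` to `r! p_r`. Polynomiality in `p₀` holds because `E` and `D` are affine in `p₀`. The
second operator is a direct computation from `D f = ∑ x^a ∂_a f`.

Commutativity is the deep part. Replace `D` by `Y = D + (k/2)(E - p₀)` (`polyDunkl`), the analogue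
of the Polychronakos operator `x_i ∂_i - k ∑_j x_i/(x_i - x_j) (1 - s_ij)`. On functions of two
chosen particles it has versions `y₁` and `y₂ = σ y₁ σ`, with `σ` the exchange, and `y₁ y₂ - y₂ y₁ =
k (y₁ - y₂) σ` (`pairDunkl_comm_relation`). Since `y₁` commutes with summation over the second
particle (`pairDunkl_sumRight`), for `I_r = E Y^r` the product `I_r I_s` is the sum of `y₁^r y₂^s`
over ordered pairs of distinct particles, plus the diagonal term `I_{r+s}`. The exchange relation
makes the pair sum symmetric in `r` and `s` (`symm_of_comm_relation`), so the `I_r` commute. Finally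
`D` differs from `Y` by a multiple of `E - p₀`, and therefore each `E D^r` lies in the algebra
generated by the `I_r`. -/

/-! ### Linearity from commutation with generators -/

/-- The elements of `R` whose multiplication commutes with `Z`. -/
def linearitySubalgebra {K R M : Type*} [CommRing K] [CommRing R] [Algebra K R]
    [AddCommGroup M] [Module K M] [Module R M] [IsScalarTower K R M] (Z : R →ₗ[K] M) :
    Subalgebra K R where
  carrier := {u | ∀ g, Z (u * g) = u • Z g}
  mul_mem' {u v} hu hv g := by
    simp only [Set.mem_ofPred_eq] at hu hv
    rw [mul_assoc, hu, hv, mul_smul]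
  add_mem' {u v} hu hv g := by
    simp only [Set.mem_ofPred_eq] at hu hv
    rw [add_mul, map_add, hu, hv, add_smul]
  algebraMap_mem' c g := by
    rw [← Algebra.smul_def, map_smul, algebraMap_smul]

lemma inverse_mem_linearitySubalgebra {K R M : Type*} [CommRing K] [CommRing R] [Algebra K R]
    [AddCommGroup M] [Module K M] [Module R M] [IsScalarTower K R M] {Z : R →ₗ[K] M} {u v : R}
    (hu : u ∈ linearitySubalgebra Z) (h : v * u = 1) : v ∈ linearitySubalgebra Z := by
  intro g
  have e := hu (v * g)
  rw [← mul_assoc, mul_comm u v, h, one_mul] at e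
  rw [e, ← mul_smul, h, one_smul]

variable {K : Type*} [Field K]

lemma T_mem_subalgebra {A : Type*} [CommRing A] [Algebra K A]
    (S : Subalgebra K (LaurentPolynomial A)) (h : T 1 ∈ S) (h' : T (-1) ∈ S) (l : ℤ) :
    T l ∈ S := by
  have key : ∀ n : ℕ, (T (n : ℤ) : LaurentPolynomial A) ∈ S ∧ T (-(n : ℤ)) ∈ S := by
    intro n
    have e1 : (T (n : ℤ) : LaurentPolynomial A) = T 1 ^ n := by rw [T_pow]; simp
    have e2 : (T (-(n : ℤ)) : LaurentPolynomial A) = T (-1) ^ n := by rw [T_pow]; simp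
    exact ⟨e1 ▸ pow_mem h n, e2 ▸ pow_mem h' n⟩
  obtain ⟨n, rfl | rfl⟩ := Int.eq_nat_or_neg l
  · exact (key n).1
  · exact (key n).2

lemma laurent_subalgebra_eq_top {A : Type*} [CommRing A] [Algebra K A]
    (S : Subalgebra K (LaurentPolynomial A)) (h : T 1 ∈ S) (h' : T (-1) ∈ S)
    (hC : ∀ a, C a ∈ S) : S = ⊤ := by
  refine Algebra.eq_top_iff.2 fun g => ?_
  induction g using LaurentPolynomial.induction_on' with
  | add g₁ g₂ h₁ h₂ => exact add_mem h₁ h₂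
  | C_mul_T n a => exact mul_mem (hC a) (T_mem_subalgebra S h h' n)

lemma algebraMap_C (c : K) : algebraMap K (LSymX K) c = C (algebraMap K (LSym K) c) := by
  simp [LaurentPolynomial.algebraMap_apply]

/-- The inclusion of coefficients into Laurent polynomials. -/
def constHom (K A : Type*) [Field K] [CommRing A] [Algebra K A] :
    A →ₐ[K] LaurentPolynomial A :=
  { (C : A →+* LaurentPolynomial A) with
    commutes' := fun c => by
      simp [LaurentPolynomial.algebraMap_apply] }

@[simp] lemma constHom_apply {A : Type*} [CommRing A] [Algebra K A] (a : A) :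
    constHom K A a = C a := rfl

lemma lsym_subalgebra_eq_top (S : Subalgebra K (LSym K))
    (h : ∀ a, MvPolynomial.X a ∈ S) : S = ⊤ := by
  rw [eq_top_iff, ← MvPolynomial.adjoin_range_X, Algebra.adjoin_le_iff]
  rintro _ ⟨a, rfl⟩
  exact h a

/-- The elements that pass through `Z` form a subalgebra, closed under inverses of its units, so `x`
and the `p_a` already generate everything. -/
lemma linear_of_commutes_generators {M : Type*} [AddCommGroup M] [Module K M] [Module (LSymX K) M]
    [IsScalarTower K (LSymX K) M] (Z : LSymX K →ₗ[K] M)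
    (hx : ∀ g, Z (T 1 * g) = (T 1 : LSymX K) • Z g)
    (hp : ∀ a g, Z (C (MvPolynomial.X a) * g) = (C (MvPolynomial.X a) : LSymX K) • Z g)
    (u g : LSymX K) : Z (u * g) = u • Z g := by
  have hT : (T 1 : LSymX K) ∈ linearitySubalgebra Z := hx
  have : linearitySubalgebra Z = ⊤ := by
    refine laurent_subalgebra_eq_top _ hT
      (inverse_mem_linearitySubalgebra hT (by rw [← T_add]; simp)) fun a => ?_
    have : (linearitySubalgebra Z).comap (constHom K (LSym K)) = ⊤ :=
      lsym_subalgebra_eq_top _ fun a => hp a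
    exact (Subalgebra.mem_comap _ _ _).1 (this ▸ Algebra.mem_top : a ∈ _)
  exact (this ▸ Algebra.mem_top : u ∈ linearitySubalgebra Z) g

lemma eq_zero_of_commutes_generators {M : Type*} [AddCommGroup M] [Module K M]
    [Module (LSymX K) M] [IsScalarTower K (LSymX K) M] (Z : LSymX K →ₗ[K] M) (h1 : Z 1 = 0)
    (hx : ∀ g, Z (T 1 * g) = (T 1 : LSymX K) • Z g)
    (hp : ∀ a g, Z (C (MvPolynomial.X a) * g) = (C (MvPolynomial.X a) : LSymX K) • Z g) :
    Z = 0 := by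
  refine LinearMap.ext fun u => ?_
  have := linear_of_commutes_generators Z hx hp u 1
  rwa [h1, mul_one, smul_zero] at this

/-! ### Commutation relations for the Dunkl–Heckman operator -/

lemma ofMonomials_C_mul_T {M : Type*} [AddCommGroup M] [Module (LSym K) M] (v : ℤ → M)
    (f : LSym K) (l : ℤ) : ofMonomials v (C f * T l) = f • v l := by
  rw [← single_eq_C_mul_T]
  simp [ofMonomials, -single_eq_C_mul_T]

lemma ofMonomials_T {M : Type*} [AddCommGroup M] [Module (LSym K) M] (v : ℤ → M)
    (l : ℤ) : ofMonomials v (T l : LSymX K) = v l := by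
  have := ofMonomials_C_mul_T v (1 : LSym K) l
  rwa [map_one, one_mul, one_smul] at this

@[simp] lemma evalE_T (p0 : K) (l : ℤ) : evalE p0 (T l) = p p0 l := ofMonomials_T _ _

@[simp] lemma evalE_C_mul (p0 : K) (f : LSym K) (g : LSymX K) :
    evalE p0 (C f * g) = f * evalE p0 g := by
  rw [← smul_eq_C_mul, map_smul, smul_eq_mul]

@[simp] lemma p_zero (p0 : K) : p p0 0 = MvPolynomial.C p0 := by simp [p]

lemma p_of_ne (p0 : K) {a : ℤ} (h : a ≠ 0) : p p0 a = MvPolynomial.X ⟨a, h⟩ := by simp [p, h]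

@[simp] lemma evalE_one (p0 : K) : evalE p0 1 = MvPolynomial.C p0 := by
  rw [← T_zero, evalE_T, p_zero]

@[simp] lemma evalE_C (p0 : K) (f : LSym K) :
    evalE p0 (C f) = f * MvPolynomial.C p0 := by
  rw [← mul_one (C f), evalE_C_mul, evalE_one]

@[simp] lemma Delta_T (p0 : K) (l : ℤ) : Delta p0 (T l) = deltaMonomial p0 l :=
  ofMonomials_T _ _

@[simp] lemma Delta_C_mul (p0 : K) (f : LSym K) (g : LSymX K) :
    Delta p0 (C f * g) = C f * Delta p0 g := by
  rw [← smul_eq_C_mul, map_smul, smul_eq_C_mul]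

lemma deltaPos_succ (p0 : K) (l : ℕ) (hl : 0 < l) :
    deltaPos p0 (l + 1) = T 1 * deltaPos p0 l - 2 * T ((l : ℤ) + 1) + T 1 * C (p p0 l)
      + C (p p0 (l + 1)) := by
  have hI : Finset.Ioo 0 (l + 1) = insert l (Finset.Ioo 0 l) := by
    ext j; simp only [Finset.mem_Ioo, Finset.mem_insert]; omega
  unfold deltaPos
  rw [hI, Finset.sum_insert (by simp)]
  have hs : ∑ j ∈ Finset.Ioo 0 l, (2 * (T (((l + 1 : ℕ) : ℤ) - j) * C (p p0 j)) : LSymX K)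
      = T 1 * ∑ j ∈ Finset.Ioo 0 l, 2 * (T ((l : ℤ) - j) * C (p p0 j)) := by
    rw [Finset.mul_sum]
    refine Finset.sum_congr rfl fun j _ => ?_
    have : (((l + 1 : ℕ) : ℤ) - j) = 1 + ((l : ℤ) - j) := by push_cast; ring
    rw [this, T_add]; ring
  rw [hs]
  have e1 : (((l + 1 : ℕ) : ℤ) - (l : ℤ)) = 1 := by push_cast; ring
  rw [e1]
  push_cast
  rw [T_add]
  ring

lemma deltaPos_one (p0 : K) :
    deltaPos p0 1 = - 2 * T 1 + T 1 * C (p p0 0) + C (p p0 1) := by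
  have h : Finset.Ioo 0 1 = ∅ := by decide
  simp [deltaPos, h]; ring

lemma starX_add (g h : LSymX K) : starX (g + h) = starX g + starX h := by simp [starX]

lemma starX_mul (g h : LSymX K) : starX (g * h) = starX g * starX h := by simp [starX]

@[simp] lemma starX_C (f : LSym K) : starX (C f) = C (starHom f) := by
  rw [starX, ← single_eq_C, AddMonoidAlgebra.mapRingHom_single, single_eq_C, invert_C]; rfl

@[simp] lemma starX_T (l : ℤ) : starX (T l : LSymX K) = T (-l) := by
  rw [starX, T, AddMonoidAlgebra.mapRingHom_single, map_one]
  exact invert_T l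

@[simp] lemma starHom_X (a : {a : ℤ // a ≠ 0}) :
    starHom (MvPolynomial.X a : LSym K) = MvPolynomial.X ⟨-a.1, neg_ne_zero.mpr a.2⟩ := by
  simp [starHom]

@[simp] lemma starHom_p (p0 : K) (a : ℤ) : starHom (p p0 a) = p p0 (-a) := by
  by_cases h : a = 0
  · simp [h, starHom]
  · rw [p_of_ne p0 h, starHom_X, p_of_ne]

lemma starHom_starHom (f : LSym K) : starHom (starHom f) = f := by
  have : (starHom (K := K)).comp starHom = AlgHom.id K _ := by
    ext1 a; simp
  exact DFunLike.congr_fun this f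

/-- The involution `*` of `Λ^±[x, x⁻¹]` as an algebra homomorphism. -/
def starXHom : LSymX K →ₐ[K] LSymX K :=
  { ((invert (R := LSym K) : LSymX K ≃+* LSymX K) : LSymX K →+* LSymX K).comp
      (AddMonoidAlgebra.mapRingHom ℤ (starHom (K := K)).toRingHom) with
    commutes' := fun c => by
      have := starX_C (algebraMap K (LSym K) c)
      rw [AlgHom.commutes, ← algebraMap_C] at this
      exact this }

@[simp] lemma starXHom_apply (g : LSymX K) : starXHom g = starX g := rfl

lemma starX_starX (g : LSymX K) : starX (starX g) = g := by
  induction g using LaurentPolynomial.induction_on' with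
  | add g₁ g₂ h₁ h₂ => rw [starX_add, starX_add, h₁, h₂]
  | C_mul_T n a => simp [starX_mul, starHom_starHom]

lemma deltaMonomial_neg (p0 : K) (l : ℤ) :
    deltaMonomial p0 (-l) = - starX (deltaMonomial p0 l) := by
  unfold deltaMonomial
  rcases lt_trichotomy l 0 with h | rfl | h
  · simp only [Int.neg_pos, h, if_true, not_lt_of_gt h, if_false, h.ne, Int.natAbs_neg]
    rw [← starXHom_apply, map_neg, neg_neg, starXHom_apply, starX_starX]
  · simp [← starXHom_apply]
  · have h' : ¬ 0 < -l := by omega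
    simp only [h, if_true, h', if_false, neg_eq_zero, h.ne', Int.natAbs_neg]

lemma deltaMonomial_natCast (p0 : K) (l : ℕ) (hl : 0 < l) :
    deltaMonomial p0 l = deltaPos p0 l := by
  simp [deltaMonomial, hl]

lemma deltaMonomial_zero (p0 : K) : deltaMonomial p0 0 = 0 := by simp [deltaMonomial]

lemma deltaMonomial_succ_nat (p0 : K) (l : ℕ) :
    deltaMonomial p0 ((l : ℤ) + 1) = T 1 * deltaMonomial p0 l - 2 * T ((l : ℤ) + 1)
      + T 1 * C (p p0 l) + C (p p0 (l + 1)) := by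
  rcases Nat.eq_zero_or_pos l with rfl | hl
  · have := deltaMonomial_natCast p0 1 one_pos
    rw [Nat.cast_one] at this
    rw [Nat.cast_zero, zero_add, this, deltaMonomial_zero, deltaPos_one]
    ring
  · have := deltaMonomial_natCast p0 (l + 1) l.succ_pos
    rw [Nat.cast_add, Nat.cast_one] at this
    rw [this, deltaMonomial_natCast p0 l hl, deltaPos_succ p0 l hl]

/-- One recursion covers both signs of `l`. It replaces the case definition of `Δ` in what follows.
-/
lemma deltaMonomial_succ (p0 : K) (l : ℤ) :
    deltaMonomial p0 (l + 1) = T 1 * deltaMonomial p0 l - 2 * T (l + 1)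
      + T 1 * C (p p0 l) + C (p p0 (l + 1)) := by
  rcases le_or_gt 0 l with h | h
  · lift l to ℕ using h
    exact deltaMonomial_succ_nat p0 l
  · obtain ⟨n, rfl⟩ : ∃ n : ℕ, l = -(n + 1 : ℤ) := ⟨(-l - 1).toNat, by omega⟩
    have e : -((n : ℤ) + 1) + 1 = -(n : ℤ) := by ring
    have hT : (T 1 : LSymX K) * T (-1) = 1 := by rw [← T_add]; simp
    have e2 : (T (-(n + 1 : ℤ)) : LSymX K) = T (-1) * T (-(n : ℤ)) := by rw [← T_add]; ring_nf
    -- Applying `*` to the recursion at `n` gives, up to the factor `x`, the recursion at `-(n +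
    -- 1)`; cancelling that factor accounts for `hT`.
    rw [e, deltaMonomial_neg, deltaMonomial_neg, deltaMonomial_succ_nat]
    simp only [← starXHom_apply, map_add, map_sub, map_mul, map_ofNat]
    simp only [starXHom_apply, starX_T, starX_C, starHom_p, e2]
    linear_combination (starX (deltaMonomial p0 n) + C (p p0 (-(n : ℤ)))
      - 2 * T (-(n : ℤ))) * hT

/-- The failure of `Δ` to be linear over `x` is expressed through `E` alone, which is what makes
arguments on generators possible. -/
lemma Delta_T_mul (p0 : K) (g : LSymX K) :
    Delta p0 (T 1 * g) = T 1 * Delta p0 g - 2 * (T 1 * g) + T 1 * C (evalE p0 g)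
      + C (evalE p0 (T 1 * g)) := by
  induction g using LaurentPolynomial.induction_on' with
  | add g₁ g₂ h₁ h₂ => simp only [mul_add, map_add, h₁, h₂]; ring
  | C_mul_T n a =>
    have e : (T 1 * (C a * T n) : LSymX K) = C a * T (n + 1) := by rw [T_add]; ring
    rw [e]
    simp only [Delta_C_mul, Delta_T, evalE_C_mul, evalE_T, deltaMonomial_succ, map_mul]
    ring

@[simp] lemma partialX_T (l : ℤ) : partialX (T l : LSymX K) = (l : LSymX K) * T l := by
  have h : partialX (T l : LSymX K) = partialLin (C 1 * T l) := by rw [map_one, one_mul]; rfl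
  rw [h, partialLin_apply]
  simp [mul_comm, Algebra.smul_def]

@[simp] lemma partialX_C (f : LSym K) : partialX (C f) = partialLSym f := by
  have h : partialX (C f) = partialLin (C f * T 0) := by rw [T_zero, mul_one]; rfl
  rw [h, partialLin_apply]
  simp

lemma dunkl_apply (k p0 : K) (g : LSymX K) :
    dunkl k p0 g = partialX g - (k / 2) • Delta p0 g := rfl

@[simp] lemma dunkl_one (k p0 : K) : dunkl k p0 1 = 0 := by
  rw [dunkl_apply, ← T_zero, Delta_T, deltaMonomial_zero, partialX_T]; simp

lemma dunkl_X_mul (k p0 : K) (a : {a : ℤ // a ≠ 0}) (g : LSymX K) :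
    dunkl k p0 (C (MvPolynomial.X a) * g)
      = C (MvPolynomial.X a) * dunkl k p0 g + (a.1 : LSymX K) * T a.1 * g := by
  have h : partialLSym (MvPolynomial.X a : LSym K) = (a.1 : LSymX K) * T a.1 := by
    simp [partialLSym]
  rw [dunkl_apply, dunkl_apply, Derivation.leibniz, partialX_C, h, Delta_C_mul]
  simp only [smul_eq_mul, Algebra.smul_def]
  ring

lemma dunkl_T_mul [CharZero K] (k p0 : K) (g : LSymX K) :
    dunkl k p0 (T 1 * g) = T 1 * dunkl k p0 g + (1 + k) • (T 1 * g)
      - (k / 2) • (T 1 * C (evalE p0 g) + C (evalE p0 (T 1 * g))) := by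
  have hk : algebraMap K (LSymX K) k = 2 * algebraMap K (LSymX K) (k / 2) := by
    rw [← map_ofNat (algebraMap K (LSymX K)) 2, ← map_mul]; congr 1; field_simp
  rw [dunkl_apply, dunkl_apply, Derivation.leibniz, partialX_T, Delta_T_mul]
  simp only [smul_eq_mul, Algebra.smul_def, map_add, map_one, hk, Int.cast_one]
  ring

/-! ### The two symmetries -/

lemma cmsIntegral_apply (k p0 : K) (r : ℕ) (f : LSym K) :
    cmsIntegral k p0 r f = evalE p0 ((dunkl k p0 ^ r) (C f)) := rfl

/-- `A` and `B` themselves need not be linear over the Laurent ring; only their defects on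
generators have to agree. -/
lemma eq_of_commutes_generators (A B : Module.End K (LSymX K)) (h1 : A 1 = B 1)
    (hx : ∀ g, A (T 1 * g) - B (T 1 * g) = T 1 * (A g - B g))
    (hp : ∀ a g, A (C (MvPolynomial.X a) * g) - B (C (MvPolynomial.X a) * g)
      = C (MvPolynomial.X a) * (A g - B g)) : A = B := by
  rw [← sub_eq_zero]
  refine eq_zero_of_commutes_generators _ (by simp [h1]) (fun g => ?_) fun a g => ?_
  · exact hx g
  · exact hp a g

lemma evalE_starX (p0 : K) (g : LSymX K) : evalE p0 (starX g) = starHom (evalE p0 g) := by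
  induction g using LaurentPolynomial.induction_on' with
  | add g₁ g₂ h₁ h₂ => simp only [starX_add, map_add, h₁, h₂]
  | C_mul_T n a => simp [starX_mul]

lemma partialLSym_starHom (f : LSym K) :
    partialLSym (starHom f) = - starX (partialLSym f) := by
  induction f using MvPolynomial.induction_on with
  | C c =>
    have h : starHom (MvPolynomial.C c : LSym K) = MvPolynomial.C c := by simp [starHom]
    rw [h]
    have h2 : partialLSym (MvPolynomial.C c : LSym K) = 0 := by simp [partialLSym]
    rw [h2, ← starXHom_apply, map_zero, neg_zero]
  | add f g hf hg => simp only [map_add, hf, hg, starX_add, neg_add]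
  | mul_X f a hf =>
    have h : ∀ b, partialLSym (MvPolynomial.X b : LSym K) = (b.1 : LSymX K) * T b.1 := by
      intro b; simp [partialLSym]
    rw [map_mul, Derivation.leibniz, Derivation.leibniz, hf, starHom_X, h, h]
    simp only [smul_eq_C_mul, starX_add, starX_mul, starX_C, starHom_X, starX_T]
    simp only [← starXHom_apply, map_intCast]
    push_cast
    ring

lemma partialX_starX (g : LSymX K) : partialX (starX g) = - starX (partialX g) := by
  induction g using LaurentPolynomial.induction_on' with
  | add g₁ g₂ h₁ h₂ => simp only [starX_add, map_add, h₁, h₂, neg_add]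
  | C_mul_T n a =>
    simp only [starX_mul, starX_C, starX_T, Derivation.leibniz, starX_add, partialX_T, partialX_C,
      partialLSym_starHom, smul_eq_mul]
    simp only [← starXHom_apply, map_intCast]
    push_cast
    ring

lemma Delta_starX (p0 : K) (g : LSymX K) : Delta p0 (starX g) = - starX (Delta p0 g) := by
  induction g using LaurentPolynomial.induction_on' with
  | add g₁ g₂ h₁ h₂ => simp only [starX_add, map_add, h₁, h₂, neg_add]
  | C_mul_T n a =>
    simp only [starX_mul, starX_C, starX_T, Delta_C_mul, Delta_T, deltaMonomial_neg]
    ring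

lemma dunkl_starX (k p0 : K) (g : LSymX K) : dunkl k p0 (starX g) = - starX (dunkl k p0 g) := by
  rw [dunkl_apply, dunkl_apply, partialX_starX, Delta_starX]
  simp only [← starXHom_apply, map_sub, map_smul, smul_neg]
  abel

lemma dunkl_pow_starX (k p0 : K) (r : ℕ) (g : LSymX K) :
    (dunkl k p0 ^ r) (starX g) = (-1 : K) ^ r • starX ((dunkl k p0 ^ r) g) := by
  induction r with
  | zero => simp
  | succ r ih =>
    rw [pow_succ', Module.End.mul_apply, Module.End.mul_apply, ih, map_smul, dunkl_starX, pow_succ]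
    module

lemma starConj_cmsIntegral (k p0 : K) (r : ℕ) :
    starConj (cmsIntegral k p0 r) = (-1 : K) ^ r • cmsIntegral k p0 r := by
  refine LinearMap.ext fun f => ?_
  have e : starConj (cmsIntegral k p0 r) f = starHom (cmsIntegral k p0 r (starHom f)) := rfl
  rw [e, LinearMap.smul_apply, cmsIntegral_apply, cmsIntegral_apply, ← evalE_starX, ← starX_C,
    dunkl_pow_starX]
  simp only [← starXHom_apply, map_smul]
  simp only [starXHom_apply, starX_starX]
  rw [← algebraMap_smul (LSym K) ((-1 : K) ^ r) ((dunkl k p0 ^ r) (C f)), map_smul,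
    algebraMap_smul]

/-- The extension of `θ` to `Λ^±[x, x⁻¹]` with `x ↦ x`. -/
def thetaX (k : K) : LSymX K →ₐ[K] LSymX K :=
  { AddMonoidAlgebra.mapRingHom ℤ (thetaHom k).toRingHom with
    commutes' := fun c => by
      have : AddMonoidAlgebra.mapRingHom ℤ (thetaHom k).toRingHom
          (C (algebraMap K (LSym K) c)) = C (thetaHom k (algebraMap K (LSym K) c)) := by
        rw [← single_eq_C, AddMonoidAlgebra.mapRingHom_single, single_eq_C]; rfl
      rw [AlgHom.commutes, ← algebraMap_C] at this
      exact this }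

@[simp] lemma thetaX_C (k : K) (f : LSym K) : thetaX k (C f) = C (thetaHom k f) := by
  change AddMonoidAlgebra.mapRingHom ℤ (thetaHom k).toRingHom (C f) = _
  rw [← single_eq_C, AddMonoidAlgebra.mapRingHom_single, single_eq_C]; rfl

@[simp] lemma thetaX_T (k : K) (l : ℤ) : thetaX k (T l) = T l := by
  change AddMonoidAlgebra.mapRingHom ℤ (thetaHom k).toRingHom (T l) = _
  rw [T, AddMonoidAlgebra.mapRingHom_single, map_one]

lemma thetaHom_inv_apply {k : K} (hk : k ≠ 0) (f : LSym K) : thetaHom k⁻¹ (thetaHom k f) = f :=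
  (theta k hk).symm_apply_apply f

lemma thetaX_inv_apply {k : K} (hk : k ≠ 0) (g : LSymX K) : thetaX k⁻¹ (thetaX k g) = g := by
  induction g using LaurentPolynomial.induction_on' with
  | add g₁ g₂ h₁ h₂ => simp only [map_add, h₁, h₂]
  | C_mul_T n a => simp [thetaHom_inv_apply hk]

@[simp] lemma thetaHom_X (k : K) (a : {a : ℤ // a ≠ 0}) :
    thetaHom k (MvPolynomial.X a) = k • MvPolynomial.X a := by simp [thetaHom]

/-- The scalar `p₀` is fixed by `θ`, so the common factor `k⁻¹` at `l = 0` forces the parameter `k *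
p0`. -/
lemma thetaHom_p {k : K} (hk : k ≠ 0) (p0 : K) (l : ℤ) :
    thetaHom k⁻¹ (p p0 l) = k⁻¹ • p (k * p0) l := by
  by_cases h : l = 0
  · subst h
    rw [p_zero, p_zero, MvPolynomial.algHom_C, MvPolynomial.smul_eq_C_mul, ← map_mul,
      inv_mul_cancel_left₀ hk, MvPolynomial.algebraMap_eq]
  · rw [p_of_ne _ h, p_of_ne _ h, thetaHom_X]

lemma evalE_thetaX {k : K} (hk : k ≠ 0) (p0 : K) (g : LSymX K) :
    thetaHom k⁻¹ (evalE p0 (thetaX k g)) = k⁻¹ • evalE (k * p0) g := by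
  induction g using LaurentPolynomial.induction_on' with
  | add g₁ g₂ h₁ h₂ => simp only [map_add, h₁, h₂, smul_add]
  | C_mul_T n a => simp [thetaHom_inv_apply hk, thetaHom_p hk]

/-- Both sides have the same defects: `p_a` contributes `k a x^a`, and `x` contributes `1 + k = k (1
+ k⁻¹)` together with `E`-terms matched by `evalE_thetaX`. -/
lemma thetaX_dunkl [CharZero K] {k : K} (hk : k ≠ 0) (p0 : K) (g : LSymX K) :
    thetaX k⁻¹ (dunkl k p0 (thetaX k g)) = k • dunkl k⁻¹ (k * p0) g := by
  have := eq_of_commutes_generators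
    ((thetaX k⁻¹).toLinearMap ∘ₗ dunkl k p0 ∘ₗ (thetaX k).toLinearMap)
    (k • dunkl k⁻¹ (k * p0)) (by simp) (fun g => ?_) fun a g => ?_
  · exact LinearMap.congr_fun this g
  · have e := evalE_thetaX hk p0 g
    have e' := evalE_thetaX hk p0 (T 1 * g)
    simp only [LinearMap.comp_apply, AlgHom.toLinearMap_apply, LinearMap.smul_apply, map_mul,
      thetaX_T] at e' ⊢
    have hC : ∀ f : LSym K, (C (k⁻¹ • f) : LSymX K) = k⁻¹ • C f := fun f =>
      map_smul (constHom K (LSym K)) _ _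
    simp only [dunkl_T_mul, map_add, map_sub, map_smul, map_mul, thetaX_T, thetaX_C, e, e',
      thetaX_inv_apply hk, hC, smul_add, smul_sub, smul_smul, mul_smul_comm, mul_sub, add_smul]
    field_simp
    module
  · have hC : ∀ (c : K) (f : LSym K), (C (c • f) : LSymX K) = c • C f := fun c f =>
      map_smul (constHom K (LSym K)) _ _
    simp only [LinearMap.comp_apply, AlgHom.toLinearMap_apply, LinearMap.smul_apply, map_mul,
      thetaX_C, thetaHom_X, hC, smul_mul_assoc, map_smul, dunkl_X_mul, map_add, map_intCast,
      thetaX_T, thetaX_inv_apply hk, smul_smul, mul_inv_cancel₀ hk, one_smul, smul_add, mul_sub,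
      mul_smul_comm]
    abel

lemma thetaX_dunkl_pow [CharZero K] {k : K} (hk : k ≠ 0) (p0 : K) (r : ℕ) (g : LSymX K) :
    (dunkl k p0 ^ r) (thetaX k g) = k ^ r • thetaX k ((dunkl k⁻¹ (k * p0) ^ r) g) := by
  have h : ∀ g, dunkl k p0 (thetaX k g) = k • thetaX k (dunkl k⁻¹ (k * p0) g) := by
    intro g
    have := congrArg (thetaX k) (thetaX_dunkl hk p0 g)
    have hi := thetaX_inv_apply (inv_ne_zero hk) (dunkl k p0 (thetaX k g))
    rw [inv_inv] at hi
    rw [hi, map_smul] at this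
    exact this
  induction r with
  | zero => simp
  | succ r ih =>
    rw [pow_succ' (dunkl k p0), pow_succ' (dunkl k⁻¹ (k * p0)), Module.End.mul_apply,
      Module.End.mul_apply, ih, map_smul, h, smul_smul, pow_succ]

lemma theta_conj_cmsIntegral [CharZero K] {k : K} (hk : k ≠ 0) (p0 : K) (r : ℕ) :
    (theta k hk).symm.toLinearMap ∘ₗ cmsIntegral k p0 r ∘ₗ (theta k hk).toLinearMap
      = k ^ ((r : ℤ) - 1) • cmsIntegral k⁻¹ (k * p0) r := by
  refine LinearMap.ext fun f => ?_
  have e : ((theta k hk).symm.toLinearMap ∘ₗ cmsIntegral k p0 r ∘ₗ (theta k hk).toLinearMap) f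
    = thetaHom k⁻¹ (cmsIntegral k p0 r (thetaHom k f)) := rfl
  -- The `r` factors `D` give `k ^ r` and the single `E` gives `k⁻¹`, whence the exponent `r - 1`.
  rw [e, LinearMap.smul_apply, cmsIntegral_apply, cmsIntegral_apply, ← thetaX_C,
    thetaX_dunkl_pow hk, ← map_smul, evalE_thetaX hk,
    ← algebraMap_smul (LSym K) (k ^ r), map_smul, algebraMap_smul, smul_smul, zpow_sub₀ hk]
  congr 1
  simp [field]

/-! ### Differential operators between modules -/

section DiffOp

variable {A M N P : Type*} [CommRing A] [Algebra K A]
  [AddCommGroup M] [Module K M] [Module A M] [IsScalarTower K A M]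
  [AddCommGroup N] [Module K N] [Module A N] [IsScalarTower K A N]
  [AddCommGroup P] [Module K P] [Module A P] [IsScalarTower K A P]

/-- The commutator of a linear map with the multiplication by `f`. -/
def commMul (f : A) (L : M →ₗ[K] N) : M →ₗ[K] N :=
  L ∘ₗ Algebra.lsmul K K M f - Algebra.lsmul K K N f ∘ₗ L

lemma commMul_apply (f : A) (L : M →ₗ[K] N) (m : M) : commMul f L m = L (f • m) - f • L m := rfl

lemma commMul_add (f : A) (L L' : M →ₗ[K] N) :
    commMul f (L + L') = commMul f L + commMul f L' := by
  ext m; simp only [commMul_apply, LinearMap.add_apply, smul_add]; abel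

lemma commMul_smul (f : A) (c : K) (L : M →ₗ[K] N) :
    commMul f (c • L) = c • commMul f L := by
  ext m; simp only [commMul_apply, LinearMap.smul_apply, smul_sub, smul_comm f c]

lemma commMul_zero (f : A) : commMul f (0 : M →ₗ[K] N) = 0 := by
  ext m; simp [commMul_apply]

lemma commMul_comp (f : A) (L : N →ₗ[K] P) (L' : M →ₗ[K] N) :
    commMul f (L ∘ₗ L') = L ∘ₗ commMul f L' + commMul f L ∘ₗ L' := by
  ext m; simp [commMul_apply]

variable (A) in
/-- Differential operators of order at most `n` between modules over a commutative algebra. -/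
def IsModDiffOpLE : ℕ → (M →ₗ[K] N) → Prop
  | 0, L => ∀ f : A, commMul f L = 0
  | n + 1, L => ∀ f : A, IsModDiffOpLE n (commMul f L)

lemma isModDiffOpLE_iff (n : ℕ) (L : Module.End K A) :
    IsModDiffOpLE A n L ↔ IsDiffOpLE n L := by
  induction n generalizing L with
  | zero => rfl
  | succ n ih => exact forall_congr' fun f => ih _

lemma IsModDiffOpLE.zero (n : ℕ) : IsModDiffOpLE A n (0 : M →ₗ[K] N) := by
  induction n with
  | zero => exact fun f => commMul_zero f
  | succ n ih => intro f; rw [commMul_zero]; exact ih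

lemma IsModDiffOpLE.add {n : ℕ} {L L' : M →ₗ[K] N} (h : IsModDiffOpLE A n L)
    (h' : IsModDiffOpLE A n L') : IsModDiffOpLE A n (L + L') := by
  induction n generalizing L L' with
  | zero => intro f; rw [commMul_add, h f, h' f, add_zero]
  | succ n ih => intro f; rw [commMul_add]; exact ih (h f) (h' f)

lemma IsModDiffOpLE.smul {n : ℕ} {L : M →ₗ[K] N} (c : K) (h : IsModDiffOpLE A n L) :
    IsModDiffOpLE A n (c • L) := by
  induction n generalizing L with
  | zero => intro f; rw [commMul_smul, h f, smul_zero]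
  | succ n ih => intro f; rw [commMul_smul]; exact ih (h f)

lemma IsModDiffOpLE.succ {n : ℕ} {L : M →ₗ[K] N} (h : IsModDiffOpLE A n L) :
    IsModDiffOpLE A (n + 1) L := by
  induction n generalizing L with
  | zero => intro f; rw [h f]; exact .zero 0
  | succ n ih => exact fun f => ih (h f)

lemma IsModDiffOpLE.comp {m n : ℕ} {L : N →ₗ[K] P} {L' : M →ₗ[K] N}
    (h : IsModDiffOpLE A m L) (h' : IsModDiffOpLE A n L') :
    IsModDiffOpLE A (m + n) (L ∘ₗ L') := by
  -- Induction on the total order: by the Leibniz rule a commutator lowers the order of one factor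
  -- and keeps the other.
  obtain ⟨s, hs⟩ : ∃ s, s = m + n := ⟨_, rfl⟩
  rw [← hs]
  induction s generalizing m n L L' with
  | zero =>
    obtain ⟨rfl, rfl⟩ : m = 0 ∧ n = 0 := by omega
    intro f
    rw [commMul_comp, h f, h' f, LinearMap.comp_zero, LinearMap.zero_comp, add_zero]
  | succ s ih =>
    intro f
    rw [commMul_comp]
    refine .add ?_ ?_
    · rcases n with _ | n
      · rw [h' f, LinearMap.comp_zero]; exact .zero s
      · exact ih h (h' f) (by omega)
    · rcases m with _ | m
      · rw [h f, LinearMap.zero_comp]; exact .zero s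
      · exact ih (h f) h' (by omega)

lemma IsModDiffOpLE.pow {L : Module.End K M} (h : IsModDiffOpLE A 1 L) (r : ℕ) :
    IsModDiffOpLE A r (L ^ r) := by
  induction r with
  | zero =>
    intro f
    ext m
    simp [commMul_apply]
  | succ r ih => rw [pow_succ]; exact ih.comp h

lemma isModDiffOpLE_restrictScalars (L : M →ₗ[A] N) :
    IsModDiffOpLE A 0 (L.restrictScalars K) := by
  intro f
  ext m
  simp [commMul_apply]

lemma IsModDiffOpLE.iterate_commMul {n r : ℕ} {L : M →ₗ[K] N} (h : IsModDiffOpLE A n L)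
    (hr : n < r) (f : A) : (commMul f)^[r] L = 0 := by
  induction n generalizing r L with
  | zero =>
    obtain ⟨r, rfl⟩ : ∃ r', r = r' + 1 := ⟨r - 1, by omega⟩
    rw [Function.iterate_succ_apply, h f]
    exact Function.iterate_fixed (commMul_zero f) r
  | succ n ih =>
    obtain ⟨r, rfl⟩ : ∃ r', r = r' + 1 := ⟨r - 1, by omega⟩
    rw [Function.iterate_succ_apply]
    exact ih (h f) (by omega)

lemma iterate_commMul_comp_left (f : A) {L : N →ₗ[K] P} (hL : commMul f L = 0)
    (L' : M →ₗ[K] N) (r : ℕ) : (commMul f)^[r] (L ∘ₗ L') = L ∘ₗ (commMul f)^[r] L' := by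
  induction r with
  | zero => rfl
  | succ r ih =>
    rw [Function.iterate_succ_apply', ih, commMul_comp, hL, LinearMap.zero_comp, add_zero,
      Function.iterate_succ_apply']

lemma iterate_commMul_comp_right (f : A) (L : N →ₗ[K] P) {L' : M →ₗ[K] N}
    (hL : commMul f L' = 0) (r : ℕ) :
    (commMul f)^[r] (L ∘ₗ L') = (commMul f)^[r] L ∘ₗ L' := by
  induction r with
  | zero => rfl
  | succ r ih =>
    rw [Function.iterate_succ_apply', ih, commMul_comp, hL, LinearMap.comp_zero, zero_add,
      Function.iterate_succ_apply']

/-- Higher Leibniz formula for the derivation `commMul f`; only two terms survive since its square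
kills `L`. -/
lemma iterate_commMul_mul (f : A) {L : Module.End K M} (hL : commMul f (commMul f L) = 0)
    (Q : Module.End K M) (n : ℕ) :
    (commMul f)^[n + 1] (L * Q)
      = L * (commMul f)^[n + 1] Q + (n + 1 : K) • (commMul f L * (commMul f)^[n] Q) := by
  have mul : ∀ L L' : Module.End K M, commMul f (L * L') = L * commMul f L' + commMul f L * L' :=
    fun L L' => commMul_comp f L L'
  induction n with
  | zero => simp [mul]
  | succ n ih =>
    rw [Function.iterate_succ_apply', ih, commMul_add, commMul_smul, mul, mul, hL, zero_mul,
      add_zero, ← Function.iterate_succ_apply' (commMul f),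
      ← Function.iterate_succ_apply' (commMul f)]
    push_cast
    module

/-- Each of the `r` commutators must hit a different factor, in `r!` ways. The vanishing of one
further commutator is carried along because the induction needs it. -/
lemma iterate_commMul_pow (f : A) {L : Module.End K M} (hL : commMul f (commMul f L) = 0)
    (r : ℕ) : (commMul f)^[r] (L ^ r) = (r.factorial : K) • commMul f L ^ r ∧
      (commMul f)^[r + 1] (L ^ r) = 0 := by
  induction r with
  | zero =>
    refine ⟨by simp, ?_⟩
    ext m
    simp [commMul_apply]
  | succ r ih =>
    have hz : (commMul f)^[r + 2] (L ^ r) = 0 := by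
      rw [Function.iterate_succ_apply', ih.2, commMul_zero]
    constructor
    · rw [pow_succ', iterate_commMul_mul f hL, ih.1, ih.2, mul_zero, zero_add, mul_smul_comm,
        ← pow_succ', smul_smul, Nat.factorial_succ]
      push_cast
      rfl
    · rw [pow_succ', iterate_commMul_mul f hL, ih.2, hz, mul_zero, mul_zero, zero_add, smul_zero]

/-! ### Polynomial families of differential operators -/

variable (A) in
/-- Families of differential operators of order at most `n` that are polynomial in a parameter. -/
def polyFamily (n : ℕ) : Submodule K (K → (M →ₗ[K] N)) :=
  Submodule.span K {Φ | ∃ (i : ℕ) (L : M →ₗ[K] N), IsModDiffOpLE A n L ∧ Φ = fun t => t ^ i • L}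

lemma affine_mem_polyFamily {n : ℕ} {L L' : M →ₗ[K] N} (h : IsModDiffOpLE A n L)
    (h' : IsModDiffOpLE A n L') : (fun t : K => L + t • L') ∈ polyFamily A n := by
  have e : (fun t : K => L + t • L') = (fun t : K => t ^ 0 • L) + fun t => t ^ 1 • L' := by
    ext t; simp
  rw [e]
  exact add_mem (Submodule.subset_span ⟨0, L, h, rfl⟩) (Submodule.subset_span ⟨1, L', h', rfl⟩)

lemma comp_mem_polyFamily {m n : ℕ} {Φ : K → (N →ₗ[K] P)} {Ψ : K → (M →ₗ[K] N)}
    (h : Φ ∈ polyFamily A m) (h' : Ψ ∈ polyFamily A n) :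
    (fun t => Φ t ∘ₗ Ψ t) ∈ polyFamily A (m + n) := by
  induction h using Submodule.span_induction with
  | zero =>
    have : (fun t => (0 : K → (N →ₗ[K] P)) t ∘ₗ Ψ t) = 0 := by ext; simp
    rw [this]; exact zero_mem _
  | add Φ₁ Φ₂ _ _ h₁ h₂ =>
    have : (fun t => (Φ₁ + Φ₂) t ∘ₗ Ψ t)
      = (fun t => Φ₁ t ∘ₗ Ψ t) + fun t => Φ₂ t ∘ₗ Ψ t := by ext; simp
    rw [this]; exact add_mem h₁ h₂
  | smul c Φ₁ _ h₁ =>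
    have : (fun t => (c • Φ₁) t ∘ₗ Ψ t) = c • (fun t => Φ₁ t ∘ₗ Ψ t) := by ext; simp
    rw [this]; exact Submodule.smul_mem _ _ h₁
  | mem Φ hΦ =>
    obtain ⟨i, L, hL, rfl⟩ := hΦ
    induction h' using Submodule.span_induction with
    | zero =>
      have : (fun t => (t ^ i • L) ∘ₗ (0 : K → (M →ₗ[K] N)) t) = 0 := by ext; simp
      rw [this]; exact zero_mem _
    | add Ψ₁ Ψ₂ _ _ h₁ h₂ =>
      have : (fun t => (t ^ i • L) ∘ₗ (Ψ₁ + Ψ₂) t)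
        = (fun t => (t ^ i • L) ∘ₗ Ψ₁ t) + fun t => (t ^ i • L) ∘ₗ Ψ₂ t := by ext; simp
      rw [this]; exact add_mem h₁ h₂
    | smul c Ψ₁ _ h₁ =>
      have : (fun t => (t ^ i • L) ∘ₗ (c • Ψ₁) t) = c • (fun t => (t ^ i • L) ∘ₗ Ψ₁ t) := by
        ext t; simp [smul_comm c]
      rw [this]; exact Submodule.smul_mem _ _ h₁
    | mem Ψ hΨ =>
      obtain ⟨j, L', hL', rfl⟩ := hΨ
      refine Submodule.subset_span ⟨i + j, L ∘ₗ L', hL.comp hL', ?_⟩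
      ext t m
      simp [pow_add, mul_smul]

lemma pow_mem_polyFamily {Φ : K → Module.End K M} (h : Φ ∈ polyFamily A 1) (r : ℕ) :
    (fun t => Φ t ^ r) ∈ polyFamily A r := by
  induction r with
  | zero =>
    have h1 : IsModDiffOpLE A 0 (1 : Module.End K M) := fun f => by ext m; simp [commMul_apply]
    exact Submodule.subset_span ⟨0, 1, h1, by simp⟩
  | succ r ih =>
    have := comp_mem_polyFamily ih h
    simp only [pow_succ]
    exact this

lemma exists_coefficients_of_mem_polyFamily {n : ℕ} {Φ : K → (M →ₗ[K] N)}
    (h : Φ ∈ polyFamily A n) : ∃ (m : ℕ) (L : ℕ → (M →ₗ[K] N)), (∀ i, IsModDiffOpLE A n (L i)) ∧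
      ∀ t, Φ t = ∑ i ∈ Finset.range (m + 1), t ^ i • L i := by
  have key : ∃ L : ℕ →₀ (M →ₗ[K] N), (∀ i, IsModDiffOpLE A n (L i)) ∧
      ∀ t, Φ t = L.sum fun i l => t ^ i • l := by
    induction h using Submodule.span_induction with
    | zero => exact ⟨0, fun i => .zero n, fun t => by simp⟩
    | add Φ₁ Φ₂ _ _ h₁ h₂ =>
      obtain ⟨L₁, h₁, e₁⟩ := h₁
      obtain ⟨L₂, h₂, e₂⟩ := h₂
      refine ⟨L₁ + L₂, fun i => (h₁ i).add (h₂ i), fun t => ?_⟩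
      rw [Finsupp.sum_add_index' (by simp) (by simp), ← e₁, ← e₂]
      rfl
    | smul c Φ₁ _ h₁ =>
      obtain ⟨L₁, h₁, e₁⟩ := h₁
      refine ⟨c • L₁, fun i => (h₁ i).smul c, fun t => ?_⟩
      rw [Finsupp.sum_smul_index' (by simp), Pi.smul_apply, e₁, Finsupp.smul_sum]
      simp only [smul_comm c]
    | mem Φ hΦ =>
      obtain ⟨i, L, hL, rfl⟩ := hΦ
      refine ⟨Finsupp.single i L, fun j => ?_, fun t => by simp⟩
      rw [Finsupp.single_apply]
      split_ifs
      · exact hL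
      · exact .zero n
  obtain ⟨L, hL, e⟩ := key
  refine ⟨L.support.sup id, L, hL, fun t => ?_⟩
  rw [e, Finsupp.sum_of_support_subset]
  · intro i hi
    rw [Finset.mem_range, Nat.lt_succ_iff]
    exact Finset.le_sup (f := id) hi
  · simp

end DiffOp

lemma isModDiffOpLE_dunkl (k p0 : K) : IsModDiffOpLE (LSym K) 1 (dunkl k p0) := by
  have h : IsModDiffOpLE (LSym K) 1 (partialX (K := K)).toLinearMap := by
    intro f g
    refine LinearMap.ext fun m => ?_
    have e : ∀ u : LSymX K, (partialX (K := K)).toLinearMap u = partialX u := fun _ => rfl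
    simp only [commMul_apply, smul_eq_C_mul, e, Derivation.leibniz, smul_eq_mul,
      LinearMap.zero_apply]
    ring
  have e : dunkl k p0 = partialX.toLinearMap + (-(k / 2)) • (Delta p0).restrictScalars K := by
    refine LinearMap.ext fun g => ?_
    change partialX g - (k / 2) • Delta p0 g = partialX g + (-(k / 2)) • Delta p0 g
    module
  rw [e]
  exact h.add ((isModDiffOpLE_restrictScalars _).succ.smul _)

/-- An affine function of `p0` is interpolated from its values at `0` and `1`; the slope is nonzero
only for `l = 0`. -/
lemma p_affine (p0 : K) (l : ℤ) : p p0 l = p 0 l + p0 • (p 1 l - p 0 l) := by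
  by_cases h : l = 0
  · simp [h, MvPolynomial.smul_eq_C_mul]
  · simp [p_of_ne _ h]

lemma evalE_affine (p0 : K) (g : LSymX K) :
    evalE p0 g = evalE 0 g + p0 • (evalE 1 g - evalE 0 g) := by
  induction g using LaurentPolynomial.induction_on' with
  | add g₁ g₂ h₁ h₂ => rw [map_add, map_add, map_add, h₁, h₂]; module
  | C_mul_T n a =>
    simp only [evalE_C_mul, evalE_T]
    rw [p_affine p0, ← mul_sub, mul_add, mul_smul_comm]

lemma deltaMonomial_affine (p0 : K) (l : ℤ) :
    deltaMonomial p0 l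
      = deltaMonomial 0 l + p0 • (deltaMonomial 1 l - deltaMonomial 0 l) := by
  have hT : IsUnit (T 1 : LSymX K) := isUnit_T 1
  -- The defect from affineness is multiplied by the unit `x` when `l` grows by one, so its
  -- vanishing at `0` spreads in both directions.
  have step : ∀ l : ℤ, deltaMonomial p0 (l + 1)
      - (deltaMonomial 0 (l + 1) + p0 • (deltaMonomial 1 (l + 1) - deltaMonomial 0 (l + 1)))
      = T 1 * (deltaMonomial p0 l
        - (deltaMonomial 0 l + p0 • (deltaMonomial 1 l - deltaMonomial 0 l))) := by
    intro l
    have hC : ∀ l, (C (p p0 l) : LSymX K) = C (p 0 l) + p0 • (C (p 1 l) - C (p 0 l)) := by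
      intro l
      rw [p_affine p0, map_add, ← constHom_apply (K := K) (p0 • _), map_smul, map_sub]
      rfl
    simp only [deltaMonomial_succ, hC, Algebra.smul_def]
    ring
  rw [← sub_eq_zero]
  induction l using Int.induction_on with
  | zero => simp [deltaMonomial_zero]
  | succ n ih => rw [step, ih, mul_zero]
  | pred n ih =>
    have := step (-(n : ℤ) - 1)
    rw [sub_add_cancel, ih] at this
    exact (hT.mul_right_eq_zero).1 this.symm

lemma Delta_affine (p0 : K) (g : LSymX K) :
    Delta p0 g = Delta 0 g + p0 • (Delta 1 g - Delta 0 g) := by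
  induction g using LaurentPolynomial.induction_on' with
  | add g₁ g₂ h₁ h₂ => rw [map_add, map_add, map_add, h₁, h₂]; module
  | C_mul_T n a =>
    simp only [Delta_C_mul, Delta_T]
    rw [deltaMonomial_affine p0, ← mul_sub, mul_add, mul_smul_comm]

lemma isModDiffOpLE_cmsIntegral (k p0 : K) (r : ℕ) :
    IsModDiffOpLE (LSym K) r (cmsIntegral k p0 r) := by
  have hE := isModDiffOpLE_restrictScalars (K := K) (evalE p0)
  have hi := isModDiffOpLE_restrictScalars (K := K) (Algebra.linearMap (LSym K) (LSymX K))
  have := hE.comp (((isModDiffOpLE_dunkl k p0).pow r).comp hi)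
  rwa [zero_add, add_zero] at this

lemma isDiffOp_cmsIntegral [CharZero K] (k p0 : K) (r : ℕ) : IsDiffOp r (cmsIntegral k p0 r) := by
  refine ⟨(isModDiffOpLE_iff _ _).1 (isModDiffOpLE_cmsIntegral k p0 r), fun m hm h => ?_⟩
  set f : LSym K := MvPolynomial.X ⟨1, one_ne_zero⟩ with hf
  have h0 := ((isModDiffOpLE_iff _ _).2 h).iterate_commMul hm f
  have hE := isModDiffOpLE_restrictScalars (K := K) (evalE p0) f
  have hi := isModDiffOpLE_restrictScalars (K := K) (Algebra.linearMap (LSym K) (LSymX K)) f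
  -- The symbol of `D` in the direction `p_1` is `x`, so the symbol of `E D^r` is `E (x^r) = p_r`.
  have hX : commMul f (dunkl k p0) = LinearMap.mulLeft K (T 1 : LSymX K) := by
    refine LinearMap.ext fun g => ?_
    rw [commMul_apply, smul_eq_C_mul, smul_eq_C_mul, dunkl_X_mul, LinearMap.mulLeft_apply]
    push_cast
    ring
  have hXX : commMul f (commMul f (dunkl k p0)) = 0 := by
    rw [hX]
    refine LinearMap.ext fun g => ?_
    simp only [commMul_apply, smul_eq_C_mul, LinearMap.mulLeft_apply, LinearMap.zero_apply]
    ring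
  unfold cmsIntegral at h0
  rw [iterate_commMul_comp_left f hE, iterate_commMul_comp_right f _ hi,
    (iterate_commMul_pow f hXX r).1, hX, LinearMap.pow_mulLeft] at h0
  have h1 := LinearMap.congr_fun h0 1
  simp only [LinearMap.comp_apply, LinearMap.smul_apply, LinearMap.mulLeft_apply,
    LinearMap.restrictScalars_apply, Algebra.linearMap_apply, map_one, mul_one,
    LinearMap.zero_apply, T_pow] at h1
  -- Since `m < r`, the index `r` is nonzero and `p_r` is a free generator, not the possibly zero
  -- scalar `p₀`.
  rw [← algebraMap_smul (LSym K) (r.factorial : K), map_smul, evalE_T, algebraMap_smul,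
    p_of_ne p0 (by have := hm.pos; simp; omega)] at h1
  refine MvPolynomial.X_ne_zero _ ((smul_eq_zero.1 h1).resolve_left ?_)
  exact_mod_cast r.factorial_ne_zero

lemma cmsIntegral_polynomial (k : K) (r : ℕ) :
    ∃ (m : ℕ) (A : ℕ → Module.End K (LSym K)), (∀ i, IsDiffOpLE r (A i)) ∧
      ∀ p0 : K, cmsIntegral k p0 r = ∑ i ∈ Finset.range (m + 1), p0 ^ i • A i := by
  have hE : (fun p0 : K => (evalE p0).restrictScalars K) ∈ polyFamily (LSym K) 0 := by
    have e : (fun p0 : K => (evalE p0).restrictScalars K) = fun p0 =>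
        (evalE 0).restrictScalars K + p0 • (evalE (1 : K) - evalE 0).restrictScalars K := by
      ext1 p0
      exact LinearMap.ext (evalE_affine p0)
    rw [e]
    exact affine_mem_polyFamily (isModDiffOpLE_restrictScalars _)
      (isModDiffOpLE_restrictScalars _)
  have hD : (fun p0 : K => dunkl k p0) ∈ polyFamily (LSym K) 1 := by
    have e : (fun p0 : K => dunkl k p0) = fun p0 => dunkl k 0
        + p0 • ((- (k / 2)) • (Delta (1 : K) - Delta 0).restrictScalars K) := by
      ext1 p0
      refine LinearMap.ext fun g => ?_
      simp only [dunkl_apply, LinearMap.add_apply, LinearMap.smul_apply,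
        LinearMap.restrictScalars_apply, LinearMap.sub_apply]
      rw [Delta_affine p0]
      module
    rw [e]
    exact affine_mem_polyFamily (isModDiffOpLE_dunkl k 0)
      ((isModDiffOpLE_restrictScalars _).succ.smul _)
  have hi : (fun _ : K => (Algebra.linearMap (LSym K) (LSymX K)).restrictScalars K)
      ∈ polyFamily (LSym K) 0 :=
    Submodule.subset_span ⟨0, (Algebra.linearMap (LSym K) (LSymX K)).restrictScalars K,
      isModDiffOpLE_restrictScalars _, by simp⟩
  have := comp_mem_polyFamily hE (comp_mem_polyFamily (pow_mem_polyFamily hD r) hi)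
  rw [zero_add, add_zero] at this
  obtain ⟨m, L, hL, e⟩ := exists_coefficients_of_mem_polyFamily this
  exact ⟨m, L, fun i => (isModDiffOpLE_iff _ _).1 (hL i), e⟩

/-! ### The second operator -/

lemma dd_mul (a : ℤ) (f g : LSym K) : dd a (f * g) = f * dd a g + g * dd a f := by
  by_cases h : a = 0
  · simp [dd, h]
  · simp [dd, h, Derivation.leibniz, smul_add]

lemma dd_X (a : ℤ) (b : {a : ℤ // a ≠ 0}) :
    dd a (MvPolynomial.X b : LSym K) = if b.1 = a then MvPolynomial.C (a : K) else 0 := by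
  by_cases h : a = 0
  · simp [dd, h, b.2]
  · by_cases hb : b.1 = a
    · have : b = ⟨a, h⟩ := Subtype.ext hb
      subst this
      simp [dd, h, MvPolynomial.smul_eq_C_mul]
    · have : b ≠ ⟨a, h⟩ := fun e => hb (by rw [e])
      simp [dd, h, hb, MvPolynomial.pderiv_X_of_ne this]

lemma dd_C (a : ℤ) (c : K) : dd a (MvPolynomial.C c : LSym K) = 0 := by
  by_cases h : a = 0
  · simp [dd, h]
  · simp [dd, h]

lemma coeff_smul (f : LSym K) (g : LSymX K) (a : ℤ) : (f • g).coeff a = f * g.coeff a := rfl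

lemma coeff_partialLSym (f : LSym K) (a : ℤ) : (partialLSym f).coeff a = dd a f := by
  induction f using MvPolynomial.induction_on with
  | C c =>
    rw [dd_C]
    have h2 : partialLSym (MvPolynomial.C c : LSym K) = 0 := by simp [partialLSym]
    rw [h2]; rfl
  | add f g hf hg =>
    rw [map_add, map_add, ← hf, ← hg]; rfl
  | mul_X f b hf =>
    have h : partialLSym (MvPolynomial.X b : LSym K) = C (MvPolynomial.C (b.1 : K)) * T b.1 := by
      simp [partialLSym]
    rw [Derivation.leibniz, dd_mul, ← hf, dd_X, h, ← single_eq_C_mul_T,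
      AddMonoidAlgebra.coeff_add, Finsupp.add_apply, coeff_smul, coeff_smul,
      AddMonoidAlgebra.coeff_single, Finsupp.single_apply]
    split_ifs with hb
    · rw [hb]
    · rfl

lemma partialLSym_eq_sum (f : LSym K) (S : Finset ℤ) (hS : ∀ a, dd a f ≠ 0 → a ∈ S) :
    partialLSym f = ∑ a ∈ S, C (dd a f) * T a := by
  refine LaurentPolynomial.ext fun b => ?_
  rw [coeff_partialLSym]
  have : (∑ a ∈ S, (C (dd a f) * T a : LSymX K)).coeff b
      = ∑ a ∈ S, (C (dd a f) * T a : LSymX K).coeff b := by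
    simp [AddMonoidAlgebra.coeff_sum, Finsupp.finsetSum_apply]
  rw [this]
  simp only [← single_eq_C_mul_T, AddMonoidAlgebra.coeff_single, Finsupp.single_apply]
  rw [Finset.sum_ite_eq']
  split_ifs with h
  · rfl
  · by_contra h'
    exact h (hS b h')

/-- `E` turns the end terms of `Δ (x^a)` into two copies of `p₀ p_a`, so everything carries a factor
`2`, which cancels the `1/2` in `D`. -/
lemma evalE_deltaMonomial_of_pos (p0 : K) {a : ℤ} (ha : 0 < a) :
    evalE p0 (deltaMonomial p0 a)
      = 2 * (p0 • p p0 a + ∑ j ∈ Finset.Ioo 0 a, p p0 (a - j) * p p0 j - (a : K) • p p0 a) := by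
  lift a to ℕ using ha.le
  have hs : ∑ j ∈ Finset.Ioo (0 : ℤ) a, p p0 (a - j) * p p0 j
      = ∑ j ∈ Finset.Ioo 0 a, p p0 ((a : ℤ) - j) * p p0 j := by
    refine (Finset.sum_nbij (fun j : ℕ => (j : ℤ)) ?_ ?_ ?_ ?_).symm
    · intro j hj
      simp only [Finset.mem_Ioo] at hj ⊢
      omega
    · intro i _ j _ h
      exact Int.ofNat_inj.1 h
    · intro j hj
      simp only [Finset.coe_Ioo, Set.mem_Ioo] at hj
      refine ⟨j.toNat, ?_, ?_⟩
      · simp only [Finset.coe_Ioo, Set.mem_Ioo]; omega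
      · simp only; omega
    · intro j _; rfl
  have hn : ∀ u : LSymX K, evalE p0 (2 * u) = 2 * evalE p0 u := by
    intro u; rw [two_mul, map_add, two_mul]
  have hl : (a : LSymX K) * T (a : ℤ) = C (a : LSym K) * T (a : ℤ) := by simp
  rw [hs, deltaMonomial_natCast p0 a (by exact_mod_cast ha), deltaPos, mul_comm (T _) (C _),
    map_sub, map_add, map_add, map_sum, mul_assoc, hn, hl, evalE_C_mul, evalE_C_mul, evalE_C,
    evalE_T, p_zero]
  simp only [hn, mul_comm (T _) (C _), evalE_C_mul, evalE_T, MvPolynomial.smul_eq_C_mul,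
    ← Finset.mul_sum]
  have : (MvPolynomial.C ((a : ℤ) : K) : LSym K) = (a : LSym K) := by simp
  rw [this]
  simp only [mul_comm (p p0 _) (p p0 ((a : ℤ) - _))]
  ring

lemma evalE_deltaMonomial_of_neg (p0 : K) {a : ℤ} (ha : a < 0) :
    evalE p0 (deltaMonomial p0 a)
      = - 2 * (p0 • p p0 a + ∑ j ∈ Finset.Ioo a 0, p p0 (a - j) * p p0 j + (a : K) • p p0 a) := by
  have h := deltaMonomial_neg p0 (-a)
  rw [neg_neg] at h
  rw [h, map_neg, evalE_starX, evalE_deltaMonomial_of_pos p0 (by omega : 0 < -a)]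
  simp only [map_mul, map_add, map_sub, map_ofNat, map_sum, map_smul, starHom_p, neg_neg]
  have hs : ∑ j ∈ Finset.Ioo 0 (-a), p p0 (-(-a - j)) * p p0 (-j)
      = ∑ j ∈ Finset.Ioo a 0, p p0 (a - j) * p p0 j := by
    refine Finset.sum_nbij (fun j : ℤ => -j) ?_ ?_ ?_ ?_
    · intro j hj
      simp only [Finset.mem_Ioo] at hj ⊢
      omega
    · intro i _ j _ h
      exact neg_inj.1 h
    · intro j hj
      simp only [Finset.coe_Ioo, Set.mem_Ioo] at hj
      refine ⟨-j, ?_, ?_⟩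
      · simp only [Finset.coe_Ioo, Set.mem_Ioo]; omega
      · simp
    · intro j _
      congr 2
      ring
  rw [hs]
  push_cast
  rw [neg_smul]
  ring

lemma finsum_subtype_eq_sum_ite {M : Type*} [AddCommMonoid M] (P : ℤ → Prop) [DecidablePred P]
    (F : ℤ → M) (S : Finset ℤ) (hS : ∀ a, F a ≠ 0 → a ∈ S) :
    ∑ᶠ a : {a : ℤ // P a}, F a = ∑ a ∈ S, if P a then F a else 0 := by
  rw [← Finset.sum_filter]
  refine (finsum_set_coe_eq_finsum_mem {a | P a}).trans
    (finsum_mem_eq_sum_of_inter_support_eq F ?_)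
  ext a
  simp only [Set.mem_inter_iff, Set.mem_ofPred_eq, Function.mem_support, Finset.coe_filter]
  exact ⟨fun h => ⟨⟨hS a h.2, h.1⟩, h.2⟩, fun h => ⟨h.1.2, h.2⟩⟩

/-- Pairs are grouped by their sum `c`, because `∂_{a+b}` sees only the sum; `I c` lists the
admissible second entries. -/
lemma finsum_pairs_eq_sum {M : Type*} [AddCommMonoid M] (P : ℤ × ℤ → Prop)
    (I : ℤ → Finset ℤ) (hI : ∀ ab, P ab ↔ ab.2 ∈ I (ab.1 + ab.2))
    (F : ℤ × ℤ → M) (S : Finset ℤ) (hS : ∀ ab, F ab ≠ 0 → ab.1 + ab.2 ∈ S) :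
    ∑ᶠ ab : {ab : ℤ × ℤ // P ab}, F ab = ∑ c ∈ S, ∑ j ∈ I c, F (c - j, j) := by
  have hinj : Function.Injective fun cj : (Σ _ : ℤ, ℤ) => (cj.1 - cj.2, cj.2) := by
    rintro ⟨c, j⟩ ⟨c', j'⟩ h
    simp only [Prod.mk.injEq] at h
    obtain ⟨h1, rfl⟩ := h
    obtain rfl : c = c' := by omega
    rfl
  rw [Finset.sum_sigma', ← Finset.sum_image (f := F)
    (g := fun cj : (Σ _ : ℤ, ℤ) => (cj.1 - cj.2, cj.2)) hinj.injOn]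
  refine (finsum_set_coe_eq_finsum_mem {ab | P ab}).trans
    (finsum_mem_eq_sum_of_inter_support_eq F ?_)
  ext ⟨a, b⟩
  simp only [Set.mem_inter_iff, Set.mem_ofPred_eq, Function.mem_support, Finset.coe_image,
    Set.mem_image, Finset.mem_coe, Finset.mem_sigma]
  constructor
  · rintro ⟨h1, h2⟩
    exact ⟨⟨⟨a + b, b⟩, ⟨hS _ h2, (hI _).1 h1⟩, by simp⟩, h2⟩
  · rintro ⟨⟨⟨c, j⟩, ⟨-, h1⟩, h⟩, h2⟩
    simp only [Prod.mk.injEq] at h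
    obtain ⟨rfl, rfl⟩ := h
    exact ⟨(hI _).2 (by simpa using h1), h2⟩

lemma evalE_dunkl_C_mul_T (k p0 : K) (g : LSym K) (a : ℤ) (S : Finset ℤ)
    (hS : ∀ b, dd b g ≠ 0 → b ∈ S) :
    evalE p0 (dunkl k p0 (C g * T a)) = ∑ b ∈ S, p p0 (a + b) * dd b g
      + (a : K) • (p p0 a * g) - (k / 2) • (g * evalE p0 (deltaMonomial p0 a)) := by
  have hk : ∀ u : LSymX K, evalE p0 ((k / 2) • u) = (k / 2) • evalE p0 u := by
    intro u
    rw [← algebraMap_smul (LSym K) (k / 2) u, map_smul, algebraMap_smul]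
  have ha : (a : LSymX K) = C (a : LSym K) := by simp
  have e : (T a * ∑ b ∈ S, C (dd b g) * T b : LSymX K)
      = ∑ b ∈ S, C (dd b g) * T (a + b) := by
    rw [Finset.mul_sum]
    refine Finset.sum_congr rfl fun b _ => ?_
    rw [T_add]; ring
  rw [dunkl_apply, Delta_C_mul, Delta_T, Derivation.leibniz, partialX_C, partialX_T,
    partialLSym_eq_sum g S hS, map_sub, map_add, smul_eq_mul, smul_eq_mul, hk, e, map_sum, ha,
    evalE_C_mul, evalE_C_mul, evalE_C_mul, evalE_T]
  simp only [evalE_C_mul, evalE_T, mul_comm (dd _ g)]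
  have : (a : K) • (p p0 a * g) = (a : LSym K) * (p p0 a * g) := by
    rw [MvPolynomial.smul_eq_C_mul]; simp
  rw [this]
  ring

lemma cmsIntegral_two [CharZero K] (k p0 : K) (f : LSym K) :
    cmsIntegral k p0 2 f = laurentCMS k p0 f := by
  -- A single finite set of indices supports all first and second derivatives of `f`, so every sum
  -- becomes a sum over `S`, compared term by term.
  obtain ⟨S, hS, hSS⟩ : ∃ S : Finset ℤ, (∀ a, dd a f ≠ 0 → a ∈ S) ∧
      ∀ a b, dd a (dd b f) ≠ 0 → a ∈ S := by
    refine ⟨(finite_dd f).toFinset ∪ (finite_dd_dd f).toFinset.image Prod.fst,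
      fun a h => ?_, fun a b h => ?_⟩
    · exact Finset.mem_union_left _ (by simpa using h)
    · refine Finset.mem_union_right _ (Finset.mem_image.2 ⟨(a, b), ?_, rfl⟩)
      simpa using h
  have h2 : cmsIntegral k p0 2 f = ∑ a ∈ S, evalE p0 (dunkl k p0 (C (dd a f) * T a)) := by
    have h1 : dunkl k p0 (C f) = ∑ a ∈ S, C (dd a f) * T a := by
      have h0 : Delta p0 (C f) = 0 := by
        rw [← mul_one (C f), Delta_C_mul, ← T_zero, Delta_T, deltaMonomial_zero, mul_zero]
      rw [dunkl_apply, h0, smul_zero, sub_zero, partialX_C, partialLSym_eq_sum f S hS]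
    rw [cmsIntegral_apply, pow_two, Module.End.mul_apply, h1, map_sum, map_sum]
  rw [h2, laurentCMS]
  have f1 : ∑ᶠ ab : ℤ × ℤ, p p0 (ab.1 + ab.2) * dd ab.1 (dd ab.2 f)
      = ∑ a ∈ S, ∑ b ∈ S, p p0 (a + b) * dd b (dd a f) := by
    rw [finsum_eq_sum_of_support_subset (s := S ×ˢ S), Finset.sum_product_right]
    · simp only [add_comm]
    · rintro ⟨a, b⟩ h
      have h' : dd a (dd b f) ≠ 0 := fun h0 => h (by simp [h0])
      simp only [Finset.coe_product, Set.mem_prod, Finset.mem_coe]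
      exact ⟨hSS a b h', hS b fun h0 => h' (by rw [h0, map_zero])⟩
  have f2 := finsum_pairs_eq_sum (fun ab : ℤ × ℤ => 0 < ab.1 ∧ 0 < ab.2)
    (fun c => Finset.Ioo 0 c) (by rintro ⟨a, b⟩; simp only [Finset.mem_Ioo]; omega)
    (fun ab => p p0 ab.1 * p p0 ab.2 * dd (ab.1 + ab.2) f) S
    (fun ab h => hS _ (right_ne_zero_of_mul h))
  have f3 := finsum_pairs_eq_sum (fun ab : ℤ × ℤ => ab.1 < 0 ∧ ab.2 < 0)
    (fun c => Finset.Ioo c 0) (by rintro ⟨a, b⟩; simp only [Finset.mem_Ioo]; omega)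
    (fun ab => p p0 ab.1 * p p0 ab.2 * dd (ab.1 + ab.2) f) S
    (fun ab h => hS _ (right_ne_zero_of_mul h))
  have f4 := finsum_subtype_eq_sum_ite (fun a => 0 < a) (fun a => p p0 a * dd a f) S
    (fun a h => hS _ (right_ne_zero_of_mul h))
  have f5 := finsum_subtype_eq_sum_ite (fun a => a < 0) (fun a => p p0 a * dd a f) S
    (fun a h => hS _ (right_ne_zero_of_mul h))
  have f6 : ∑ᶠ a : ℤ, (a : K) • (p p0 a * dd a f) = ∑ a ∈ S, (a : K) • (p p0 a * dd a f) := by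
    refine finsum_eq_sum_of_support_subset _ fun a h => hS a fun h0 => h (by simp [h0])
  simp only [sub_add_cancel] at f2 f3
  rw [f1, f2, f3, f4, f5, f6]
  simp only [← Finset.sum_sub_distrib, Finset.smul_sum, ← Finset.sum_add_distrib]
  refine Finset.sum_congr rfl fun a _ => ?_
  rw [evalE_dunkl_C_mul_T k p0 (dd a f) a S fun b => hSS b a]
  have two_smul_half : ∀ u : LSym K, (k / 2) • (2 * u) = k • u := by
    intro u
    rw [two_mul, ← two_smul K u, smul_smul]
    congr 1
    field_simp
  rcases lt_trichotomy a 0 with h | rfl | h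
  · rw [evalE_deltaMonomial_of_neg p0 h, Finset.Ioo_eq_empty (by omega : ¬ (0 : ℤ) < a),
      Finset.sum_empty, ← Finset.sum_mul, neg_mul, mul_neg, mul_left_comm, smul_neg, two_smul_half]
    simp only [h, not_lt_of_gt h, if_true, if_false, mul_comm (dd a f), add_mul, smul_mul_assoc]
    module
  · rw [deltaMonomial_zero]
    simp
  · rw [evalE_deltaMonomial_of_pos p0 h, Finset.Ioo_eq_empty (by omega : ¬ a < (0 : ℤ)),
      ← Finset.sum_mul, mul_left_comm, two_smul_half]
    simp only [h, not_lt_of_gt h, if_true, if_false, Finset.sum_empty, mul_comm (dd a f),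
      add_mul, sub_mul, smul_mul_assoc]
    module

/-! ### Powers of operators with a Polychronakos commutation relation -/

section Polychronakos

variable {R N : Type*} [Ring R] [Algebra K R] [AddCommGroup N] [Module K N]

/-- Moving `y₁` past one more `y₂` adds a term in which `σ` turns the remaining `y₂` into `y₁`; the
sum telescopes. -/
lemma mul_pow_of_comm_relation {k : K} {y₁ y₂ σ : R} (hσ : σ * y₂ = y₁ * σ)
    (h : y₁ * y₂ = y₂ * y₁ + k • ((y₁ - y₂) * σ)) (s : ℕ) :
    y₁ * y₂ ^ s = y₂ ^ s * y₁ + k • ((y₁ ^ s - y₂ ^ s) * σ) := by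
  induction s with
  | zero => simp
  | succ s ih =>
    rw [pow_succ, ← mul_assoc, ih, add_mul, mul_assoc, h, smul_mul_assoc, mul_assoc _ σ, hσ,
      pow_succ y₁]
    simp only [mul_add, mul_sub, sub_mul, mul_assoc, smul_sub, mul_smul_comm]
    abel

lemma pow_mul_pow_of_comm_relation {k : K} {y₁ y₂ σ : R} (hσ : σ * y₂ = y₁ * σ)
    (hσ' : σ * y₁ = y₂ * σ) (h : y₁ * y₂ = y₂ * y₁ + k • ((y₁ - y₂) * σ)) (r s : ℕ) :
    y₁ ^ r * y₂ ^ s = y₂ ^ s * y₁ ^ r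
      + k • ((∑ a ∈ Finset.range r, y₁ ^ a * (y₁ ^ s - y₂ ^ s) * y₂ ^ (r - (a + 1))) * σ) := by
  have hp : ∀ n, σ * y₁ ^ n = y₂ ^ n * σ := by
    intro n
    induction n with
    | zero => simp
    | succ n ih => rw [pow_succ, ← mul_assoc, ih, mul_assoc, hσ', ← mul_assoc, ← pow_succ]
  induction r with
  | zero => simp
  | succ r ih =>
    rw [pow_succ', mul_assoc, ih, mul_add, ← mul_assoc, mul_pow_of_comm_relation hσ h s,
      Finset.sum_range_succ', add_mul, smul_mul_assoc, mul_assoc _ σ, hp, mul_smul_comm,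
      ← mul_assoc y₁ _ σ, Finset.mul_sum]
    simp only [Nat.reduceSubDiff, pow_zero, one_mul, zero_add, Nat.add_sub_cancel, pow_succ' y₁,
      mul_assoc, add_mul, smul_add]
    abel

/-- Conjugation by `σ` gives `Φ (y₂^s y₁^r) = Φ (y₁^s y₂^r)`, so only the commutator of the powers
matters. It has total degree `r + s - 1`, and by induction its terms cancel in pairs. -/
lemma symm_of_comm_relation {k : K} {y₁ y₂ σ : R} (hσσ : σ * σ = 1) (hσ : σ * y₂ = y₁ * σ)
    (h : y₁ * y₂ = y₂ * y₁ + k • ((y₁ - y₂) * σ)) (Φ : R →ₗ[K] N)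
    (hl : ∀ u, Φ (σ * u) = Φ u) (hr : ∀ u, Φ (u * σ) = Φ u) (r s : ℕ) :
    Φ (y₁ ^ r * y₂ ^ s) = Φ (y₁ ^ s * y₂ ^ r) := by
  have hσ' : σ * y₁ = y₂ * σ := by
    calc σ * y₁ = σ * (y₁ * σ) * σ := by rw [mul_assoc, mul_assoc, hσσ, mul_one]
      _ = y₂ * σ := by rw [← hσ, ← mul_assoc, hσσ, one_mul]
  have hp : ∀ n, σ * y₁ ^ n = y₂ ^ n * σ := by
    intro n
    induction n with
    | zero => simp
    | succ n ih => rw [pow_succ, ← mul_assoc, ih, mul_assoc, hσ', ← mul_assoc, ← pow_succ]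
  have hp' : ∀ n, σ * y₂ ^ n = y₁ ^ n * σ := by
    intro n
    induction n with
    | zero => simp
    | succ n ih => rw [pow_succ, ← mul_assoc, ih, mul_assoc, hσ, ← mul_assoc, ← pow_succ]
  obtain ⟨n, hn⟩ : ∃ n, r + s = n := ⟨_, rfl⟩
  induction n generalizing r s with
  | zero =>
    obtain ⟨rfl, rfl⟩ : r = 0 ∧ s = 0 := by omega
    rfl
  | succ n ih =>
    have e : Φ (y₁ ^ s * y₂ ^ r) = Φ (y₂ ^ s * y₁ ^ r) := by
      rw [← hl, ← mul_assoc, hp, mul_assoc, hp', ← mul_assoc, hr]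
    rw [pow_mul_pow_of_comm_relation hσ hσ' h r s, map_add, ← e, map_smul, hr, map_sum]
    have hz : ∑ a ∈ Finset.range r, Φ (y₁ ^ a * (y₁ ^ s - y₂ ^ s) * y₂ ^ (r - (a + 1))) = 0 := by
      have h1 : ∀ a ∈ Finset.range r, Φ (y₁ ^ a * (y₁ ^ s - y₂ ^ s) * y₂ ^ (r - (a + 1)))
          = Φ (y₁ ^ (r - 1 - a) * y₂ ^ (a + s)) - Φ (y₁ ^ a * y₂ ^ (r - 1 - a + s)) := by
        intro a ha
        rw [Finset.mem_range] at ha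
        rw [mul_sub, sub_mul, map_sub, ← pow_add, mul_assoc, ← pow_add,
          ih (a + s) (r - (a + 1)) (by omega)]
        congr 4 <;> omega
      -- After the inductive symmetry, the reflection `a ↦ r - 1 - a` identifies the positive and
      -- the negative terms.
      rw [Finset.sum_congr rfl h1, Finset.sum_sub_distrib, sub_eq_zero,
        ← Finset.sum_range_reflect]
      refine Finset.sum_congr rfl fun a ha => ?_
      rw [Finset.mem_range] at ha
      congr 3
      omega
    rw [hz, smul_zero, add_zero]

end Polychronakos

/-! ### Laurent polynomials in two variables -/

section Laurent

variable {A M : Type*} [CommRing A] [Algebra K A] [AddCommGroup M] [Module K M]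

/-- The linear map on Laurent polynomials with `a x^b ↦ v b a`. -/
def laurentSum (v : ℤ → A →ₗ[K] M) : LaurentPolynomial A →ₗ[K] M :=
  Finsupp.lsum K v ∘ₗ (AddMonoidAlgebra.coeffLinearEquiv K).toLinearMap

@[simp] lemma laurentSum_C_mul_T (v : ℤ → A →ₗ[K] M) (a : A) (b : ℤ) :
    laurentSum v (C a * T b) = v b a := by
  rw [← single_eq_C_mul_T]
  simp [laurentSum, -single_eq_C_mul_T]

variable (A) in
/-- The variable of a Laurent polynomial ring as a unit. -/
def varUnit : (LaurentPolynomial A)ˣ where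
  val := T 1
  inv := T (-1)
  val_inv := by rw [← T_add]; simp
  inv_val := by rw [← T_add]; simp

lemma varUnit_zpow (n : ℤ) : ((varUnit A ^ n : (LaurentPolynomial A)ˣ) : LaurentPolynomial A)
    = T n := by
  obtain ⟨m, rfl | rfl⟩ := Int.eq_nat_or_neg n
  · simp [varUnit, T_pow]
  · rw [zpow_neg, zpow_natCast, ← inv_pow, Units.val_pow_eq_pow_val]
    simp [varUnit, T_pow]

end Laurent

/-- The algebra `Λ^±[x₁^±, x₂^±]`; here `x₁ = C (T 1)` and `x₂ = T 1`. -/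
abbrev LSymXY (K : Type*) [Field K] : Type _ := LaurentPolynomial (LSymX K)

/-- The embedding of `Λ^±[x^±]` with `x ↦ x₂`. -/
def inclRight : LSymX K →ₐ[K] LSymXY K :=
  { AddMonoidAlgebra.mapRingHom ℤ (C : LSym K →+* LSymX K) with
    commutes' := fun c => by
      have : AddMonoidAlgebra.mapRingHom ℤ (C : LSym K →+* LSymX K)
          (C (algebraMap K (LSym K) c)) = C (C (algebraMap K (LSym K) c)) := by
        rw [← single_eq_C, AddMonoidAlgebra.mapRingHom_single, single_eq_C]; rfl
      rw [← algebraMap_C] at this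
      exact this.trans ((constHom K (LSymX K)).commutes c) }

@[simp] lemma inclRight_C (f : LSym K) : inclRight (C f) = C (C f) := by
  change AddMonoidAlgebra.mapRingHom ℤ (C : LSym K →+* LSymX K) (C f) = _
  rw [← single_eq_C, AddMonoidAlgebra.mapRingHom_single, single_eq_C]; rfl

@[simp] lemma inclRight_T (l : ℤ) : inclRight (T l : LSymX K) = T l := by
  change AddMonoidAlgebra.mapRingHom ℤ (C : LSym K →+* LSymX K) (T l) = _
  rw [T, AddMonoidAlgebra.mapRingHom_single, map_one]; rfl

/-- The exchange of `x₁` and `x₂`. -/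
def swapXY : LSymXY K →ₐ[K] LSymXY K :=
  { eval₂ (inclRight (K := K)).toRingHom (Units.map (C : LSymX K →+* LSymXY K).toMonoidHom
      (varUnit (LSym K))) with
    commutes' := fun c => by
      have h1 : algebraMap K (LSymXY K) c = C (algebraMap K (LSymX K) c) :=
        ((constHom K (LSymX K)).commutes c).symm
      have h2 := eval₂_C (S := LSymXY K) (inclRight (K := K)).toRingHom
        (Units.map (C : LSymX K →+* LSymXY K).toMonoidHom (varUnit (LSym K)))
        (algebraMap K (LSymX K) c)
      rw [← h1] at h2
      exact h2.trans (inclRight.commutes c) }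

@[simp] lemma swapXY_C (g : LSymX K) : swapXY (C g) = inclRight g :=
  eval₂_C _ _ g

@[simp] lemma swapXY_T (b : ℤ) : swapXY (T b : LSymXY K) = C (T b) := by
  refine (eval₂_T _ _ b).trans ?_
  rw [← map_zpow, Units.coe_map]
  exact congrArg C (varUnit_zpow b)

lemma xy_induction {P : LSymXY K → Prop} (add : ∀ G H, P G → P H → P (G + H))
    (mon : ∀ f a b, P (C (C f * T a) * T b)) (G : LSymXY K) : P G := by
  induction G using LaurentPolynomial.induction_on' with
  | add G H hG hH => exact add G H hG hH
  | C_mul_T b g =>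
    induction g using LaurentPolynomial.induction_on' with
    | add g h hg hh => rw [map_add, add_mul]; exact add _ _ hg hh
    | C_mul_T a f => exact mon f a b

lemma swapXY_inclRight (g : LSymX K) : swapXY (inclRight g) = C g := by
  induction g using LaurentPolynomial.induction_on' with
  | add g h hg hh => simp only [map_add, hg, hh]
  | C_mul_T a f => simp

lemma swapXY_swapXY (G : LSymXY K) : swapXY (swapXY G) = G := by
  induction G using LaurentPolynomial.induction_on' with
  | add G H hG hH => simp only [map_add, hG, hH]
  | C_mul_T b g => simp [swapXY_inclRight]

lemma x_sub_ne_zero : (C (T 1) - T 1 : LSymXY K) ≠ 0 := by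
  intro h
  have := congrArg (fun G : LSymXY K => G.coeff 1) (sub_eq_zero.1 h)
  simp at this

lemma exists_dividedDiff (b : ℤ) :
    ∃ q : LSymXY K, (C (T 1) - T 1) * q = C (T 1) * (C (T b) - T b) := by
  have hx1 : (C (T 1) : LSymXY K) * C (T (-1)) = 1 := by rw [← map_mul, ← T_add]; simp
  have hx2 : (T 1 : LSymXY K) * T (-1) = 1 := by rw [← T_add]; simp
  induction b using Int.induction_on with
  | zero => exact ⟨0, by simp⟩
  | succ n ih =>
    obtain ⟨q, hq⟩ := ih
    refine ⟨T 1 * q + C (T 1) * C (T n), ?_⟩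
    rw [T_add, T_add, map_mul]
    linear_combination (T 1 : LSymXY K) * hq
  | pred n ih =>
    obtain ⟨q, hq⟩ := ih
    refine ⟨T (-1) * (q - C (T (-n : ℤ))), ?_⟩
    rw [T_sub, T_sub, map_mul]
    linear_combination (T (-1) : LSymXY K) * hq + C (T (-n : ℤ)) * hx2
      - C (T (-n : ℤ)) * hx1

/-- The Laurent polynomial `x₁ (x₁^b - x₂^b) / (x₁ - x₂)`. -/
def dividedDiff (b : ℤ) : LSymXY K := (exists_dividedDiff b).choose

lemma dividedDiff_spec (b : ℤ) :
    (C (T 1) - T 1) * dividedDiff b = (C (T 1) * (C (T b) - T b) : LSymXY K) :=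
  (exists_dividedDiff b).choose_spec

lemma dividedDiff_zero : (dividedDiff 0 : LSymXY K) = 0 := by
  refine mul_left_cancel₀ x_sub_ne_zero ?_
  rw [dividedDiff_spec]; simp

/-- A twisted Leibniz rule, which becomes the relation of `y₁` with multiplication by powers of
`x₂`. -/
lemma dividedDiff_add (a b : ℤ) : (dividedDiff (b + a) : LSymXY K)
    = T a * dividedDiff b + dividedDiff a * C (T b) := by
  refine mul_left_cancel₀ x_sub_ne_zero ?_
  rw [dividedDiff_spec, T_add, T_add, map_mul]
  linear_combination (-T a : LSymXY K) * dividedDiff_spec (K := K) b - C (T b) * dividedDiff_spec (K := K) a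

lemma dividedDiff_succ (b : ℤ) : (dividedDiff (b + 1) : LSymXY K)
    = C (T 1) * dividedDiff b + C (T 1) * T b := by
  refine mul_left_cancel₀ x_sub_ne_zero ?_
  rw [dividedDiff_spec, T_add, T_add, map_mul]
  linear_combination (-(C (T 1 : LSymX K) : LSymXY K)) * dividedDiff_spec (K := K) b

lemma dividedDiff_one : (dividedDiff 1 : LSymXY K) = C (T 1) := by
  have := dividedDiff_succ (K := K) 0
  rwa [dividedDiff_zero, T_zero, zero_add, mul_zero, zero_add, mul_one] at this

lemma dividedDiff_sub_swap (b : ℤ) :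
    (dividedDiff b - swapXY (dividedDiff b) : LSymXY K) = C (T b) - T b := by
  refine mul_left_cancel₀ x_sub_ne_zero ?_
  have h := congrArg swapXY (dividedDiff_spec (K := K) b)
  simp only [map_mul, map_sub, swapXY_C, swapXY_T, inclRight_T] at h
  linear_combination h + dividedDiff_spec (K := K) b

/-! ### The Polychronakos form of the Dunkl–Heckman operator -/

/-- The operator `x^l f ↦ p_l f` with values in `Λ^± ⊂ Λ^±[x, x⁻¹]`. -/
def constE (p0 : K) : Module.End K (LSymX K) :=
  (constHom K (LSym K)).toLinearMap ∘ₗ (evalE p0).restrictScalars K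

/-- The operator `D_{k,p₀} + (k/2) (E_{p₀} - p₀)`. -/
def polyDunkl (k p0 : K) : Module.End K (LSymX K) :=
  dunkl k p0 + (k / 2) • (constE p0 - p0 • 1)

lemma polyDunkl_apply (k p0 : K) (g : LSymX K) :
    polyDunkl k p0 g = dunkl k p0 g + (k / 2) • (C (evalE p0 g) - p0 • g) := rfl

lemma polyDunkl_one (k p0 : K) : polyDunkl k p0 1 = 0 := by
  have h : (C (MvPolynomial.C p0) : LSymX K) = p0 • 1 := by
    rw [← MvPolynomial.algebraMap_eq, ← algebraMap_C, Algebra.algebraMap_eq_smul_one]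
  rw [polyDunkl_apply, dunkl_one, evalE_one, h, sub_self, smul_zero, add_zero]

lemma polyDunkl_X_mul (k p0 : K) (a : {a : ℤ // a ≠ 0}) (g : LSymX K) :
    polyDunkl k p0 (C (MvPolynomial.X a) * g)
      = C (MvPolynomial.X a) * polyDunkl k p0 g + (a.1 : LSymX K) * T a.1 * g := by
  rw [polyDunkl_apply, polyDunkl_apply, dunkl_X_mul, evalE_C_mul, map_mul]
  simp only [Algebra.smul_def]
  ring

/-- The added `E` cancels the term `E (x g)` present for `D`, so that `x` factors out on the left.
This is the reason for passing to `Y`. -/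
lemma polyDunkl_T_mul [CharZero K] (k p0 : K) (g : LSymX K) :
    polyDunkl k p0 (T 1 * g)
      = T 1 * (polyDunkl k p0 g + (1 + k) • g - k • C (evalE p0 g)) := by
  have hk : algebraMap K (LSymX K) k = 2 * algebraMap K (LSymX K) (k / 2) := by
    rw [← map_ofNat (algebraMap K (LSymX K)) 2, ← map_mul]; congr 1; field_simp
  rw [polyDunkl_apply, polyDunkl_apply, dunkl_T_mul]
  simp only [Algebra.smul_def, map_add, map_one, hk]
  ring

lemma polyDunkl_C_p (k p0 : K) (b : ℤ) :
    polyDunkl k p0 (C (p p0 b)) = (b : LSymX K) * T b := by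
  by_cases h : b = 0
  · subst h
    have e : (C (p p0 0) : LSymX K) = p0 • 1 := by
      rw [p_zero, ← MvPolynomial.algebraMap_eq, ← algebraMap_C, Algebra.algebraMap_eq_smul_one]
    rw [e, map_smul, polyDunkl_one]
    simp
  · rw [p_of_ne p0 h, ← mul_one (C (MvPolynomial.X _)), polyDunkl_X_mul, polyDunkl_one]
    ring

/-! ### The two-particle operators -/

set_option maxSynthPendingDepth 5

/-- The exchange of `x₁` and `x₂` as a linear operator. -/
def swapLin : Module.End K (LSymXY K) := swapXY.toLinearMap

@[simp] lemma swapLin_apply (G : LSymXY K) : swapLin G = swapXY G := rfl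

/-- The operator of the first particle on `Λ^±[x₁^±, x₂^±]`. -/
def pairDunkl (k p0 : K) : Module.End K (LSymXY K) :=
  laurentSum (fun b => LinearMap.mulRight K (T b) ∘ₗ (constHom K (LSymX K)).toLinearMap ∘ₗ
      polyDunkl k p0)
    + k • laurentSum (fun b => LinearMap.mulRight K (dividedDiff b) ∘ₗ inclRight.toLinearMap)

/-- The exchange of the two particles sends `g(x₁) x₂^b` to `g(x₂) x₁^b`, whereas `Y` acting on `g`
alone accounts for `g(x₂) x₂^b`; the second term is the correction. -/
lemma pairDunkl_C_mul_T (k p0 : K) (g : LSymX K) (b : ℤ) :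
    pairDunkl k p0 (C g * T b)
      = C (polyDunkl k p0 g) * T b + k • (inclRight g * dividedDiff b) := by
  rw [pairDunkl, LinearMap.add_apply, LinearMap.smul_apply, laurentSum_C_mul_T,
    laurentSum_C_mul_T]
  rfl

lemma pairDunkl_C (k p0 : K) (g : LSymX K) :
    pairDunkl k p0 (C g) = C (polyDunkl k p0 g) := by
  have := pairDunkl_C_mul_T k p0 g 0
  rwa [T_zero, mul_one, mul_one, dividedDiff_zero, mul_zero, smul_zero, add_zero] at this

lemma pairDunkl_T (k p0 : K) (b : ℤ) : pairDunkl k p0 (T b) = k • dividedDiff b := by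
  have := pairDunkl_C_mul_T k p0 1 b
  rwa [map_one, one_mul, polyDunkl_one, map_zero, zero_mul, zero_add, map_one, one_mul] at this

/-- The operator `x₁^a x₂^b ↦ x^a (p_b - x^b)`: the sum over the second particle. -/
def pairSum (p0 : K) : LSymXY K →ₗ[K] LSymX K :=
  laurentSum (fun b => LinearMap.mulRight K (C (p p0 b) - T b))

@[simp] lemma pairSum_C_mul_T (p0 : K) (g : LSymX K) (b : ℤ) :
    pairSum p0 (C g * T b) = g * (C (p p0 b) - T b) := by
  rw [pairSum, laurentSum_C_mul_T]; rfl

@[simp] lemma pairSum_C_mul (p0 : K) (g : LSymX K) (G : LSymXY K) :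
    pairSum p0 (C g * G) = g * pairSum p0 G := by
  induction G using LaurentPolynomial.induction_on' with
  | add G H hG hH => simp only [mul_add, map_add, hG, hH]
  | C_mul_T b h => rw [← mul_assoc, ← map_mul, pairSum_C_mul_T, pairSum_C_mul_T, mul_assoc]

lemma pairSum_T (p0 : K) (b : ℤ) : pairSum p0 (T b) = C (p p0 b) - T b := by
  have := pairSum_C_mul_T p0 1 b
  rwa [map_one, one_mul, one_mul] at this

/-- The sum over the second particle, as an operator on `Λ^±[x₁^±, x₂^±]`. -/
def sumRight (p0 : K) : Module.End K (LSymXY K) :=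
  (constHom K (LSymX K)).toLinearMap ∘ₗ pairSum p0

lemma sumRight_apply (p0 : K) (G : LSymXY K) : sumRight p0 G = C (pairSum p0 G) := rfl

/-- The sum over the first particle, as an operator on `Λ^±[x₁^±, x₂^±]`. -/
def sumLeft (p0 : K) : Module.End K (LSymXY K) := swapLin * sumRight p0 * swapLin

lemma sumLeft_apply (p0 : K) (G : LSymXY K) :
    sumLeft p0 G = swapXY (C (pairSum p0 (swapXY G))) := rfl

lemma sumRight_C_mul (p0 : K) (g : LSymX K) (G : LSymXY K) :
    sumRight p0 (C g * G) = C g * sumRight p0 G := by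
  rw [sumRight_apply, sumRight_apply, pairSum_C_mul, map_mul]

lemma swapXY_sumLeft (p0 : K) (G : LSymXY K) :
    swapXY (sumLeft p0 G) = sumRight p0 (swapXY G) := by
  rw [sumLeft_apply, swapXY_swapXY, sumRight_apply]

lemma swapXY_sumRight (p0 : K) (G : LSymXY K) :
    swapXY (sumRight p0 G) = sumLeft p0 (swapXY G) := by
  rw [sumLeft_apply, swapXY_swapXY, sumRight_apply]

/-- Two-particle form of `polyDunkl_T_mul`. In the particle picture `sumLeft + σ` is the sum of
`s_{1j}` over all `j`, with `s_{11} = 1`, and takes the role of `E`. -/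
lemma pairDunkl_left_mul [CharZero K] (k p0 : K) (G : LSymXY K) :
    pairDunkl k p0 (C (T 1) * G) = C (T 1) * (pairDunkl k p0 G + (1 + k) • G
      - k • (sumLeft p0 G + swapXY G)) := by
  induction G using xy_induction with
  | add G H hG hH => simp only [mul_add, map_add, hG, hH, Algebra.smul_def]; ring
  | mon f a b =>
    have hC : ∀ (c : K) (g : LSymX K), (C (c • g) : LSymXY K) = c • C g := fun c g =>
      map_smul (constHom K (LSymX K)) _ _
    have hq := dividedDiff_spec (K := K) b
    have e : pairSum p0 (swapXY (C (C f * T a))) = C f * (C (p p0 a) - T a) := by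
      rw [swapXY_C, map_mul, inclRight_C, inclRight_T, pairSum_C_mul_T]
    rw [← mul_assoc, ← map_mul, pairDunkl_C_mul_T, pairDunkl_C_mul_T, polyDunkl_T_mul,
      sumLeft_apply, map_mul swapXY, swapXY_T, mul_comm _ (C (T b : LSymX K)), pairSum_C_mul, e,
      evalE_C_mul, evalE_T]
    simp only [map_mul, map_sub, map_add, hC, swapXY_C, inclRight_C, inclRight_T]
    simp only [Algebra.smul_def, map_add, map_one]
    linear_combination (-(algebraMap K (LSymXY K) k) * C (C f) * T a) * hq

lemma pairDunkl_T_mul (k p0 : K) (a : ℤ) (G : LSymXY K) :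
    pairDunkl k p0 (T a * G) = T a * pairDunkl k p0 G + k • (dividedDiff a * swapXY G) := by
  induction G using LaurentPolynomial.induction_on' with
  | add G H hG hH => simp only [mul_add, map_add, hG, hH, Algebra.smul_def]; ring
  | C_mul_T b g =>
    have e : (T a * (C g * T b) : LSymXY K) = C g * T (b + a) := by rw [T_add]; ring
    rw [e, pairDunkl_C_mul_T, pairDunkl_C_mul_T, dividedDiff_add, T_add, map_mul, swapXY_C,
      swapXY_T]
    simp only [Algebra.smul_def]
    ring

lemma pairDunkl_X_mul (k p0 : K) (a : {a : ℤ // a ≠ 0}) (G : LSymXY K) :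
    pairDunkl k p0 (C (C (MvPolynomial.X a)) * G)
      = C (C (MvPolynomial.X a)) * pairDunkl k p0 G + (a.1 : LSymXY K) * C (T a.1) * G := by
  induction G using LaurentPolynomial.induction_on' with
  | add G H hG hH => simp only [mul_add, map_add, hG, hH]; ring
  | C_mul_T b g =>
    rw [← mul_assoc, ← map_mul, pairDunkl_C_mul_T, pairDunkl_C_mul_T, polyDunkl_X_mul, map_add,
      map_mul, map_mul, map_mul, map_mul, map_intCast, inclRight_C]
    simp only [Algebra.smul_def]
    ring

/-- The total exchange of the first particle commutes with summation over the second, as both treat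
the other particles symmetrically. -/
lemma sumRight_exchange (p0 : K) (G : LSymXY K) :
    sumLeft p0 (sumRight p0 G) + swapXY (sumRight p0 G)
      = sumRight p0 (sumLeft p0 G + swapXY G) := by
  induction G using xy_induction with
  | add G H hG hH =>
    simp only [map_add] at hG hH ⊢
    linear_combination hG + hH
  | mon f a b =>
    have e1 : swapXY (C (C f * T a) * T b : LSymXY K) = C (C f * T b) * T a := by
      simp only [map_mul, swapXY_C, swapXY_T, inclRight_C, inclRight_T]; ring
    have e3 : ∀ c : ℤ, pairSum p0 (swapXY (C (C f * T a * (C (p p0 c) - T c)) : LSymXY K))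
      = C f * (C (p p0 c) * (C (p p0 a) - T a) - (C (p p0 (a + c)) - T (a + c))) := by
      intro c
      have : (swapXY (C (C f * T a * (C (p p0 c) - T c)) : LSymXY K))
        = C (C f) * (C (C (p p0 c)) * T a - T (a + c)) := by
        rw [T_add]
        simp only [map_mul, map_sub, swapXY_C, inclRight_C, inclRight_T]; ring
      rw [this, pairSum_C_mul, map_sub, pairSum_C_mul_T, pairSum_T]
    rw [sumRight_apply p0 (C (C f * T a) * T b), pairSum_C_mul_T, sumLeft_apply, e3,
      sumLeft_apply, e1, pairSum_C_mul_T, map_add, sumRight_apply, sumRight_apply]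
    have e4 : (swapXY (C (C f * T b * (C (p p0 a) - T a)) : LSymXY K))
        = C (C f * C (p p0 a)) * T b - C (C f) * T (b + a) := by
        rw [T_add]
        simp only [map_mul, map_sub, swapXY_C, inclRight_C, inclRight_T]; ring
    rw [e4, map_sub, pairSum_C_mul_T, pairSum_C_mul_T, pairSum_C_mul_T]
    simp only [map_mul, map_sub, swapXY_C, inclRight_C, inclRight_T, T_add, add_comm b a]
    ring

/-- Linearity over `Λ^±[x₁^±]` from commutation with its generators. -/
lemma map_C_mul_of_commutes_generators (W : Module.End K (LSymXY K))
    (hx : ∀ G, W (C (T 1) * G) = C (T 1) * W G)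
    (hp : ∀ a G, W (C (C (MvPolynomial.X a)) * G) = C (C (MvPolynomial.X a)) * W G)
    (g : LSymX K) (G : LSymXY K) : W (C g * G) = C g * W G := by
  have hT : (T 1 : LSymX K) ∈ (linearitySubalgebra W).comap (constHom K (LSymX K)) := hx
  have htop : (linearitySubalgebra W).comap (constHom K (LSymX K)) = ⊤ := by
    refine laurent_subalgebra_eq_top _ hT ?_ fun f => ?_
    · refine inverse_mem_linearitySubalgebra (u := constHom K (LSymX K) (T 1)) hT ?_
      change (C (T (-1)) * C (T 1) : LSymXY K) = 1
      rw [← map_mul, ← T_add]; simp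
    · have : ((linearitySubalgebra W).comap (constHom K (LSymX K))).comap
          (constHom K (LSym K)) = ⊤ := lsym_subalgebra_eq_top _ fun a => hp a
      exact (Subalgebra.mem_comap _ _ _).1 (this ▸ Algebra.mem_top : f ∈ _)
  exact (htop ▸ Algebra.mem_top : g ∈ (linearitySubalgebra W).comap (constHom K (LSymX K))) G

/-- The first particle's operator does not distinguish the others, so it should commute with summing
over one of them. The commutator is linear over functions of `x₁`, which leaves only the powers of
`x₂`. -/
lemma pairDunkl_sumRight [CharZero K] (k p0 : K) (G : LSymXY K) :
    pairDunkl k p0 (sumRight p0 G) = sumRight p0 (pairDunkl k p0 G) := by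
  have hsm : ∀ (c : K) (g : LSymXY K), sumRight p0 (c • g) = c • sumRight p0 g := fun c g =>
    map_smul _ _ _
  set W : Module.End K (LSymXY K) :=
    pairDunkl k p0 * sumRight p0 - sumRight p0 * pairDunkl k p0 with hW
  have hWa : ∀ G, W G = pairDunkl k p0 (sumRight p0 G) - sumRight p0 (pairDunkl k p0 G) :=
    fun G => rfl
  have hx : ∀ G, W (C (T 1) * G) = C (T 1) * W G := by
    intro G
    have h := sumRight_exchange p0 G
    rw [hWa, hWa, sumRight_C_mul, pairDunkl_left_mul, pairDunkl_left_mul, sumRight_C_mul,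
      map_sub (sumRight p0), map_add (sumRight p0), hsm, hsm, ← h]
    ring
  have hp : ∀ a G, W (C (C (MvPolynomial.X a)) * G) = C (C (MvPolynomial.X a)) * W G := by
    intro a G
    have hz : sumRight p0 ((a.1 : LSymXY K) * C (T a.1) * G)
        = (a.1 : LSymXY K) * C (T a.1) * sumRight p0 G := by
      have : (a.1 : LSymXY K) * C (T a.1) = C ((a.1 : LSymX K) * T a.1) := by
        rw [map_mul, map_intCast]
      rw [this, sumRight_C_mul]
    rw [hWa, hWa, sumRight_C_mul, pairDunkl_X_mul, pairDunkl_X_mul, map_add, hz, sumRight_C_mul]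
    ring
  have hC := map_C_mul_of_commutes_generators W hx hp
  have hT : ∀ b : ℤ, W (T b) = 0 := by
    -- On `x₂^b` both compositions give functions of `x₁` alone, and the identity reduces to a
    -- recursion in `b` over the unit `x₁`.
    have form : ∀ b : ℤ, W (T b) = C ((b : LSymX K) * T b - polyDunkl k p0 (T b)
        - k • pairSum p0 (dividedDiff b)) := by
      intro b
      rw [hWa, sumRight_apply, pairSum_T, pairDunkl_C, pairDunkl_T, map_sub (polyDunkl k p0),
        polyDunkl_C_p, sumRight_apply, map_smul, ← map_sub]
    have step : ∀ b : ℤ, W (T (b + 1)) = C (T 1) * W (T b) := by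
      intro b
      rw [form, form, ← map_mul, add_comm b 1, T_add, polyDunkl_T_mul, evalE_T, add_comm 1 b,
        dividedDiff_succ, map_add, pairSum_C_mul, pairSum_C_mul, pairSum_T]
      congr 1
      simp only [Algebra.smul_def, map_add, map_one]
      push_cast
      ring
    intro b
    induction b using Int.induction_on with
    | zero =>
      rw [form, T_zero, polyDunkl_one, dividedDiff_zero]
      simp
    | succ n ih => rw [step, ih, mul_zero]
    | pred n ih =>
      have := step (-(n : ℤ) - 1)
      rw [sub_add_cancel, ih] at this
      exact (((isUnit_T 1).map (C : LSymX K →+* LSymXY K)).mul_right_eq_zero).1 this.symm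
  have : W G = 0 := by
    induction G using LaurentPolynomial.induction_on' with
    | add G H hG hH => rw [map_add, hG, hH, add_zero]
    | C_mul_T b g => rw [hC, hT, mul_zero]
  rw [hWa] at this
  exact sub_eq_zero.1 this

/-- The operator of the second particle on `Λ^±[x₁^±, x₂^±]`. -/
def pairDunklRight (k p0 : K) : Module.End K (LSymXY K) := swapLin * pairDunkl k p0 * swapLin

lemma pairDunklRight_apply (k p0 : K) (G : LSymXY K) :
    pairDunklRight k p0 G = swapXY (pairDunkl k p0 (swapXY G)) := rfl

lemma swapXY_pairDunkl (k p0 : K) (G : LSymXY K) :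
    swapXY (pairDunkl k p0 G) = pairDunklRight k p0 (swapXY G) := by
  rw [pairDunklRight_apply, swapXY_swapXY]

lemma swapXY_pairDunklRight (k p0 : K) (G : LSymXY K) :
    swapXY (pairDunklRight k p0 G) = pairDunkl k p0 (swapXY G) := by
  rw [pairDunklRight_apply, swapXY_swapXY]

lemma pairDunklRight_sumLeft [CharZero K] (k p0 : K) (G : LSymXY K) :
    pairDunklRight k p0 (sumLeft p0 G) = sumLeft p0 (pairDunklRight k p0 G) := by
  rw [pairDunklRight_apply, swapXY_sumLeft, pairDunkl_sumRight, swapXY_sumRight,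
    swapXY_pairDunkl, swapXY_swapXY]

lemma pairDunklRight_T_mul [CharZero K] (k p0 : K) (G : LSymXY K) :
    pairDunklRight k p0 (T 1 * G) = T 1 * (pairDunklRight k p0 G + (1 + k) • G
      - k • (sumRight p0 G + swapXY G)) := by
  rw [pairDunklRight_apply, map_mul, swapXY_T, pairDunkl_left_mul, map_mul, swapXY_C, inclRight_T,
    map_sub, map_add, map_smul, map_smul, map_add, swapXY_pairDunkl, swapXY_sumLeft]
  simp only [swapXY_swapXY]

lemma pairDunklRight_left_mul (k p0 : K) (a : ℤ) (G : LSymXY K) :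
    pairDunklRight k p0 (C (T a) * G)
      = C (T a) * pairDunklRight k p0 G + k • (swapXY (dividedDiff a) * swapXY G) := by
  rw [pairDunklRight_apply, map_mul, swapXY_C, inclRight_T, pairDunkl_T_mul, map_add, map_mul,
    map_smul, map_mul, swapXY_T, swapXY_swapXY, pairDunklRight_apply]

lemma pairDunklRight_X_mul (k p0 : K) (a : {a : ℤ // a ≠ 0}) (G : LSymXY K) :
    pairDunklRight k p0 (C (C (MvPolynomial.X a)) * G)
      = C (C (MvPolynomial.X a)) * pairDunklRight k p0 G + (a.1 : LSymXY K) * T a.1 * G := by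
  rw [pairDunklRight_apply, map_mul, swapXY_C, inclRight_C, pairDunkl_X_mul]
  simp only [map_add, map_mul, swapXY_C, inclRight_C, inclRight_T, map_intCast, swapXY_swapXY]
  rw [pairDunklRight_apply]

/-- The defect `Z` of the relation kills `1` and commutes with all generators, hence vanishes. -/
lemma pairDunkl_comm_relation [CharZero K] (k p0 : K) :
    pairDunkl k p0 * pairDunklRight k p0 = pairDunklRight k p0 * pairDunkl k p0
      + k • ((pairDunkl k p0 - pairDunklRight k p0) * swapLin) := by
  set Z : Module.End K (LSymXY K) := pairDunkl k p0 * pairDunklRight k p0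
    - (pairDunklRight k p0 * pairDunkl k p0
      + k • ((pairDunkl k p0 - pairDunklRight k p0) * swapLin)) with hZ
  have hZa : ∀ G, Z G = pairDunkl k p0 (pairDunklRight k p0 G)
      - (pairDunklRight k p0 (pairDunkl k p0 G)
        + k • (pairDunkl k p0 (swapXY G) - pairDunklRight k p0 (swapXY G))) := fun G => rfl
  -- `Z` is antisymmetric under exchange, so the check for `x₂` follows from that for `x₁`.
  have hsw : ∀ G, Z (swapXY G) = - swapXY (Z G) := by
    intro G
    simp only [hZa, map_sub, map_add, map_smul, swapXY_pairDunkl, swapXY_pairDunklRight,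
      swapXY_swapXY]
    simp only [Algebra.smul_def]
    ring
  have hx1 : ∀ G, Z (C (T 1) * G) = C (T 1) * Z G := by
    intro G
    have h2 := fun G => pairDunklRight_left_mul k p0 1 G
    have h3 := fun G => pairDunkl_T_mul k p0 1 G
    simp only [dividedDiff_one, swapXY_C, inclRight_T] at h2 h3
    simp only [hZa, map_mul, swapXY_C, inclRight_T, h2, pairDunkl_left_mul, map_add, map_smul,
      h3, pairDunklRight_T_mul, map_sub, swapXY_pairDunkl, swapXY_pairDunklRight, swapXY_swapXY,
      pairDunklRight_sumLeft, swapXY_sumLeft]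
    simp only [Algebra.smul_def, map_add, map_one]
    ring
  have hx2 : ∀ G, Z (T 1 * G) = T 1 * Z G := by
    intro G
    have e : (T 1 * G : LSymXY K) = swapXY (C (T 1) * swapXY G) := by
      rw [map_mul, swapXY_C, inclRight_T, swapXY_swapXY]
    rw [e, hsw, hx1, hsw, map_mul, map_neg, swapXY_swapXY, swapXY_C, inclRight_T]
    ring
  have hp : ∀ a G, Z (C (C (MvPolynomial.X a)) * G) = C (C (MvPolynomial.X a)) * Z G := by
    intro a G
    have hi1 : ∀ G, pairDunkl k p0 ((a.1 : LSymXY K) * T a.1 * G)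
        = (a.1 : LSymXY K) * pairDunkl k p0 (T a.1 * G) := by
      intro G
      rw [mul_assoc, ← zsmul_eq_mul, map_zsmul, zsmul_eq_mul]
    have hi2 : ∀ G, pairDunklRight k p0 ((a.1 : LSymXY K) * C (T a.1) * G)
        = (a.1 : LSymXY K) * pairDunklRight k p0 (C (T a.1) * G) := by
      intro G
      rw [mul_assoc, ← zsmul_eq_mul, map_zsmul, zsmul_eq_mul]
    -- The two cross terms differ by a divided difference minus its exchange, which is `x₁^a -
    -- x₂^a`, exactly the defect of `y₁ - y₂` on `p_a`.
    have hq := dividedDiff_sub_swap (K := K) a.1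
    simp only [hZa, map_mul, swapXY_C, inclRight_C, pairDunklRight_X_mul, pairDunkl_X_mul,
      map_add, hi1, hi2, pairDunkl_T_mul, pairDunklRight_left_mul, Algebra.smul_def]
    linear_combination ((a.1 : LSymXY K) * algebraMap K (LSymXY K) k * swapXY G) * hq
  have h1 : Z 1 = 0 := by
    have e1 : pairDunkl k p0 1 = 0 := by
      rw [← map_one (C : LSymX K →+* LSymXY K), pairDunkl_C, polyDunkl_one, map_zero]
    have e2 : pairDunklRight k p0 1 = 0 := by
      rw [pairDunklRight_apply, map_one, e1, map_zero]
    rw [hZa, map_one swapXY, e1, e2]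
    simp
  have htop : linearitySubalgebra Z = ⊤ := by
    have hT : (T 1 : LSymXY K) ∈ linearitySubalgebra Z := hx2
    refine laurent_subalgebra_eq_top _ hT
      (inverse_mem_linearitySubalgebra hT (by rw [← T_add]; simp)) ?_
    exact map_C_mul_of_commutes_generators Z hx1 hp
  have hzero : Z = 0 := by
    refine LinearMap.ext fun G => ?_
    have hG : G ∈ linearitySubalgebra Z := htop ▸ Algebra.mem_top
    have := hG 1
    rwa [mul_one, h1, smul_zero] at this
  exact sub_eq_zero.1 hzero

/-! ### Commutativity -/

/-- The operator `E ∘ Y^r` on `Λ^±` for the operator `Y` of `polyDunkl`. -/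
def polyIntegral (k p0 : K) (r : ℕ) : Module.End K (LSym K) :=
  (evalE p0).restrictScalars K ∘ₗ (polyDunkl k p0 ^ r) ∘ₗ (constHom K (LSym K)).toLinearMap

lemma polyIntegral_apply (k p0 : K) (r : ℕ) (f : LSym K) :
    polyIntegral k p0 r f = evalE p0 ((polyDunkl k p0 ^ r) (C f)) := rfl

/-- Summing first over the second particle and then over the first runs over all ordered pairs of
distinct particles, a symmetric set. -/
lemma evalE_pairSum_swapXY (p0 : K) (G : LSymXY K) :
    evalE p0 (pairSum p0 (swapXY G)) = evalE p0 (pairSum p0 G) := by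
  induction G using xy_induction with
  | add G H hG hH => simp only [map_add, hG, hH]
  | mon f a b =>
    have e1 : swapXY (C (C f * T a) * T b : LSymXY K) = C (C f * T b) * T a := by
      simp only [map_mul, swapXY_C, swapXY_T, inclRight_C, inclRight_T]; ring
    have e2 : ∀ a b : ℤ, evalE p0 (C f * T a * (C (p p0 b) - T b))
        = f * (p p0 b * p p0 a - p p0 (a + b)) := by
      intro a b
      have : (C f * T a * (C (p p0 b) - T b) : LSymX K)
          = C f * (C (p p0 b) * T a - T (a + b)) := by rw [T_add]; ring
      rw [this, evalE_C_mul, map_sub, evalE_C_mul, evalE_T, evalE_T]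
    rw [e1, pairSum_C_mul_T, pairSum_C_mul_T, e2, e2, add_comm, mul_comm (p p0 a)]

/-- The sum over all particles splits into those other than the chosen one and the chosen one
itself. -/
lemma C_evalE_eq (p0 : K) (g : LSymX K) :
    C (evalE p0 g) = pairSum p0 (inclRight g) + g := by
  induction g using LaurentPolynomial.induction_on' with
  | add g h hg hh => simp only [map_add, hg, hh]; ring
  | C_mul_T b f =>
    rw [map_mul inclRight, inclRight_C, inclRight_T, pairSum_C_mul_T, evalE_C_mul, evalE_T, map_mul]
    ring

lemma C_injective : Function.Injective (C : LSymX K → LSymXY K) := by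
  intro g h e
  have := congrArg (fun G : LSymXY K => G.coeff 0) e
  simpa using this

lemma polyDunkl_pow_pairSum [CharZero K] (k p0 : K) (r : ℕ) (G : LSymXY K) :
    (polyDunkl k p0 ^ r) (pairSum p0 G) = pairSum p0 ((pairDunkl k p0 ^ r) G) := by
  induction r with
  | zero => rfl
  | succ r ih =>
    rw [pow_succ' (polyDunkl k p0), pow_succ' (pairDunkl k p0), Module.End.mul_apply,
      Module.End.mul_apply, ih]
    apply C_injective
    rw [← pairDunkl_C, ← sumRight_apply, pairDunkl_sumRight, sumRight_apply]

lemma inclRight_polyDunkl_pow (k p0 : K) (s : ℕ) (g : LSymX K) :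
    inclRight ((polyDunkl k p0 ^ s) g) = (pairDunklRight k p0 ^ s) (inclRight g) := by
  induction s with
  | zero => rfl
  | succ s ih =>
    rw [pow_succ' (polyDunkl k p0), pow_succ' (pairDunklRight k p0), Module.End.mul_apply,
      Module.End.mul_apply, ← ih, pairDunklRight_apply, swapXY_inclRight, pairDunkl_C, swapXY_C]

/-- The inner sum over particles is split by `C_evalE_eq`; the diagonal part is already symmetric in
`r` and `s`. -/
lemma polyIntegral_polyIntegral [CharZero K] (k p0 : K) (r s : ℕ) (f : LSym K) :
    polyIntegral k p0 r (polyIntegral k p0 s f)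
      = evalE p0 (pairSum p0 ((pairDunkl k p0 ^ r * pairDunklRight k p0 ^ s) (C (C f))))
        + polyIntegral k p0 (r + s) f := by
  rw [polyIntegral_apply, polyIntegral_apply, polyIntegral_apply, C_evalE_eq, map_add, map_add,
    polyDunkl_pow_pairSum, inclRight_polyDunkl_pow, inclRight_C, pow_add, Module.End.mul_apply,
    Module.End.mul_apply]

lemma polyIntegral_commute [CharZero K] (k p0 : K) (r s : ℕ) :
    polyIntegral k p0 r * polyIntegral k p0 s = polyIntegral k p0 s * polyIntegral k p0 r := by
  refine LinearMap.ext fun f => ?_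
  rw [Module.End.mul_apply, Module.End.mul_apply, polyIntegral_polyIntegral,
    polyIntegral_polyIntegral, add_comm s r]
  congr 1
  have hσσ : (swapLin : Module.End K (LSymXY K)) * swapLin = 1 :=
    LinearMap.ext swapXY_swapXY
  have hσ : swapLin * pairDunklRight k p0 = pairDunkl k p0 * swapLin :=
    LinearMap.ext (swapXY_pairDunklRight k p0)
  -- `Φ` is invariant under `σ` on the left by symmetry of the pair sum, and on the right because
  -- the constant `f` involves neither `x₁` nor `x₂`.
  let Φ : Module.End K (LSymXY K) →ₗ[K] LSym K :=
    (evalE p0).restrictScalars K ∘ₗ pairSum p0 ∘ₗ LinearMap.applyₗ (C (C f))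
  have hΦ : ∀ u, Φ u = evalE p0 (pairSum p0 (u (C (C f)))) := fun u => rfl
  have hl : ∀ u, Φ (swapLin * u) = Φ u := by
    intro u
    rw [hΦ, hΦ, Module.End.mul_apply, swapLin_apply, evalE_pairSum_swapXY]
  have hr : ∀ u, Φ (u * swapLin) = Φ u := by
    intro u
    rw [hΦ, hΦ, Module.End.mul_apply, swapLin_apply, swapXY_C, inclRight_C]
  exact symm_of_comm_relation hσσ hσ (pairDunkl_comm_relation k p0) Φ hl hr r s

/-- The algebra generated by the operators `polyIntegral`. -/
def integralAlgebra (k p0 : K) : Subalgebra K (Module.End K (LSym K)) :=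
  Algebra.adjoin K (Set.range (polyIntegral k p0))

lemma polyIntegral_mem (k p0 : K) (r : ℕ) : polyIntegral k p0 r ∈ integralAlgebra k p0 :=
  Algebra.subset_adjoin (Set.mem_range_self r)

lemma commute_of_mem_integralAlgebra [CharZero K] (k p0 : K) {L L' : Module.End K (LSym K)}
    (h : L ∈ integralAlgebra k p0) (h' : L' ∈ integralAlgebra k p0) : Commute L L' := by
  refine Algebra.commute_of_mem_adjoin_of_forall_mem_commute h' ?_
  rintro _ ⟨s, rfl⟩
  refine (Algebra.commute_of_mem_adjoin_of_forall_mem_commute h ?_).symm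
  rintro _ ⟨r, rfl⟩
  exact polyIntegral_commute k p0 s r

/-- Applying `D = Y - (k/2)(E - p₀)` to `Y^a L f` either raises `a`, keeps it, or produces the
constant `I_a L f`, so the span is stable under `D`. -/
lemma dunkl_pow_mem_span (k p0 : K) (r : ℕ) :
    (dunkl k p0 ^ r) ∘ₗ (constHom K (LSym K)).toLinearMap ∈
      Submodule.span K {X : LSym K →ₗ[K] LSymX K | ∃ (a : ℕ), ∃ L ∈ integralAlgebra k p0,
        X = (polyDunkl k p0 ^ a) ∘ₗ (constHom K (LSym K)).toLinearMap ∘ₗ L} := by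
  induction r with
  | zero =>
    refine Submodule.subset_span ⟨0, 1, one_mem _, ?_⟩
    rw [pow_zero, pow_zero, Module.End.one_eq_id, Module.End.one_eq_id, LinearMap.comp_id]
  | succ r ih =>
    have e : (dunkl k p0 ^ (r + 1)) ∘ₗ (constHom K (LSym K)).toLinearMap
        = dunkl k p0 ∘ₗ ((dunkl k p0 ^ r) ∘ₗ (constHom K (LSym K)).toLinearMap) := by
      rw [pow_succ', Module.End.mul_eq_comp, LinearMap.comp_assoc]
    rw [e]
    generalize (dunkl k p0 ^ r) ∘ₗ (constHom K (LSym K)).toLinearMap = X at ih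
    induction ih using Submodule.span_induction with
    | zero => rw [LinearMap.comp_zero]; exact zero_mem _
    | add X Y _ _ hX hY => rw [LinearMap.comp_add]; exact add_mem hX hY
    | smul c X _ hX => rw [LinearMap.comp_smul]; exact Submodule.smul_mem _ _ hX
    | mem X hX =>
      obtain ⟨a, L, hL, rfl⟩ := hX
      have e2 : dunkl k p0 ∘ₗ ((polyDunkl k p0 ^ a) ∘ₗ (constHom K (LSym K)).toLinearMap ∘ₗ L)
          = (polyDunkl k p0 ^ (a + 1)) ∘ₗ (constHom K (LSym K)).toLinearMap ∘ₗ L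
            + ((- (k / 2)) • ((polyDunkl k p0 ^ 0) ∘ₗ (constHom K (LSym K)).toLinearMap ∘ₗ
                (polyIntegral k p0 a * L))
              + (k / 2 * p0) • ((polyDunkl k p0 ^ a) ∘ₗ (constHom K (LSym K)).toLinearMap ∘ₗ L)) := by
        refine LinearMap.ext fun f => ?_
        have h := polyDunkl_apply k p0 ((polyDunkl k p0 ^ a) (C (L f)))
        have h1 : (polyDunkl k p0 ^ (a + 1)) (C (L f))
            = polyDunkl k p0 ((polyDunkl k p0 ^ a) (C (L f))) := by
          rw [pow_succ', Module.End.mul_apply]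
        rw [pow_zero, Module.End.one_eq_id, LinearMap.id_comp]
        change dunkl k p0 ((polyDunkl k p0 ^ a) (C (L f))) = (polyDunkl k p0 ^ (a + 1)) (C (L f))
          + ((- (k / 2)) • C (evalE p0 ((polyDunkl k p0 ^ a) (C (L f))))
            + (k / 2 * p0) • (polyDunkl k p0 ^ a) (C (L f)))
        rw [h1, h]
        module
      rw [e2]
      exact add_mem (Submodule.subset_span ⟨a + 1, L, hL, rfl⟩)
        (add_mem (Submodule.smul_mem _ _ (Submodule.subset_span
          ⟨0, _, mul_mem (polyIntegral_mem k p0 a) hL, rfl⟩))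
          (Submodule.smul_mem _ _ (Submodule.subset_span ⟨a, L, hL, rfl⟩)))

lemma cmsIntegral_mem_integralAlgebra (k p0 : K) (r : ℕ) :
    cmsIntegral k p0 r ∈ integralAlgebra k p0 := by
  have key : ∀ X ∈ Submodule.span K {X : LSym K →ₗ[K] LSymX K | ∃ (a : ℕ),
      ∃ L ∈ integralAlgebra k p0, X = (polyDunkl k p0 ^ a) ∘ₗ (constHom K (LSym K)).toLinearMap ∘ₗ L},
      (evalE p0).restrictScalars K ∘ₗ X ∈ integralAlgebra k p0 := by
    intro X hX
    induction hX using Submodule.span_induction with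
    | zero => rw [LinearMap.comp_zero]; exact zero_mem _
    | add X Y _ _ hX hY => rw [LinearMap.comp_add]; exact add_mem hX hY
    | smul c X _ hX => rw [LinearMap.comp_smul]; exact Subalgebra.smul_mem _ hX c
    | mem X hX =>
      obtain ⟨a, L, hL, rfl⟩ := hX
      exact mul_mem (polyIntegral_mem k p0 a) hL
  exact key _ (dunkl_pow_mem_span k p0 r)

lemma cmsIntegral_commute [CharZero K] (k p0 : K) (r s : ℕ) :
    cmsIntegral k p0 r * cmsIntegral k p0 s = cmsIntegral k p0 s * cmsIntegral k p0 r :=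
  commute_of_mem_integralAlgebra k p0 (cmsIntegral_mem_integralAlgebra k p0 r)
    (cmsIntegral_mem_integralAlgebra k p0 s)

end JackLaurent

end

theorem mainTheorem2 {K : Type*} [Field K] [CharZero K] (k : K) :
    -- each operator is a differential operator of order `r`
    (∀ (p0 : K) (r : ℕ), JackLaurent.IsDiffOp r (JackLaurent.cmsIntegral k p0 r)) ∧
    -- the dependence on `p₀` is polynomial
    (∀ r : ℕ, ∃ (m : ℕ) (A : ℕ → Module.End K (JackLaurent.LSym K)),
      (∀ i, JackLaurent.IsDiffOpLE r (A i)) ∧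
      ∀ p0 : K, JackLaurent.cmsIntegral k p0 r = ∑ i ∈ Finset.range (m + 1), p0 ^ i • A i) ∧
    -- the `θ`-symmetry
    (∀ (hk : k ≠ 0) (p0 : K) (r : ℕ),
      (JackLaurent.theta k hk).symm.toLinearMap ∘ₗ JackLaurent.cmsIntegral k p0 r ∘ₗ
          (JackLaurent.theta k hk).toLinearMap
        = k ^ ((r : ℤ) - 1) • JackLaurent.cmsIntegral k⁻¹ (k * p0) r) ∧
    -- the `*`-symmetry
    (∀ (p0 : K) (r : ℕ), JackLaurent.starConj (JackLaurent.cmsIntegral k p0 r)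
        = (-1 : K) ^ r • JackLaurent.cmsIntegral k p0 r) ∧
    -- the explicit form of the second operator
    (∀ (p0 : K) (f : JackLaurent.LSym K),
      JackLaurent.cmsIntegral k p0 2 f = JackLaurent.laurentCMS k p0 f) ∧
    -- commutativity
    (∀ (p0 : K) (r s : ℕ), JackLaurent.cmsIntegral k p0 r * JackLaurent.cmsIntegral k p0 s
        = JackLaurent.cmsIntegral k p0 s * JackLaurent.cmsIntegral k p0 r) := by
  exact ⟨JackLaurent.isDiffOp_cmsIntegral k, JackLaurent.cmsIntegral_polynomial k,
    fun hk => JackLaurent.theta_conj_cmsIntegral hk, JackLaurent.starConj_cmsIntegral k,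
    JackLaurent.cmsIntegral_two k, JackLaurent.cmsIntegral_commute k⟩
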